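/- Let $k\in L_{1,\mathrm{loc}}([0,\infty))$ be a kernel of type $(\mathcal{PC})$: $k$ is nonnegative and nonincreasing on $(0,\infty)$, and there is $l\in L_{1,\mathrm{loc}}([0,\infty))$ with $(k*l)(t)=\int_0^t k(t-\tau)l(\tau)\,d\tau=1$ in $(0,\infty)$. Write $\hat f(\lambda)=\int_0^\infty e^{-\lambda\sigma}f(\sigma)\,d\sigma$. For $\tau\ge 0$ let $w(\cdot,\tau)$ be the unique nondecreasing, left-continuous function of bounded variation on $[0,\infty)$ with $w(0,\tau)=0$ and $$\hat w(\lambda,\tau)=\frac{e^{-\tau\lambda\hat k(\lambda)}}{\lambda},\qquad \lambda>0 .$$ For each $t>0$ the function $w(t,\cdot)$ is nonincreasing; with the heat kernel $H(\tau,x)=(4\pi\tau)^{-d/2}e^{-|x|^2/(4\tau)}$ on $\mathbb{R}^d$ put $$Z(t,x)=-\int_0^\infty H(\tau,x)\,d_\tau w(t,\tau),\qquad t>0,\ x\in\mathbb{R}^d ,$$ the fundamental solution of $\partial_t\big(k*[u-u_0]\big)-\Delta u=0$, $u|_{t=0}=u_0$. **Theorem.** Let $d\ge 1$ be an integer, let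 $k$ be of type $(\mathcal{PC})$, and let $u_0\in L_1(\mathbb{R}^d)\cap L_2(\mathbb{R}^d)$ (complex-valued) have Fourier transform $\widetilde{u_0}(\xi)=\int_{\mathbb{R}^d}e^{-ix\cdot\xi}u_0(x)\,dx$ with $\widetilde{u_0}(0)\neq 0$. Let $u(t,x)=\int_{\mathbb{R}^d}Z(t,x-y)u_0(y)\,dy$. Then there is a constant $c>0$, independent of $t$, such that for almost all $t\ge 1$ one has $u(t,\cdot)\in L_2(\mathbb{R}^d)$ and $$\|u(t,\cdot)\|_{L_2(\mathbb{R}^d)}\ \ge\ c\,k(t)^{\min\{1,\,d/4\}} .$$ -/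

import Mathlib

noncomputable section

namespace Subdiffusion

open MeasureTheory Set

/-- Convolution on the positive half-line, `(f * g)(t) = ∫₀ᵗ f (t - τ) g τ dτ`. -/
def halfLineConv (f g : ℝ → ℝ) (t : ℝ) : ℝ :=
  ∫ τ in (0 : ℝ)..t, f (t - τ) * g τ

/-- `(k, l) ∈ PC`: both kernels are locally integrable on `[0, ∞)`, `k` is nonnegative and
nonincreasing on `(0, ∞)`, and `k * l = 1` in `(0, ∞)`. The last identity is one between
locally integrable functions, hence is required for almost every `t`. -/
structure IsPCPair (k l : ℝ → ℝ) : Prop where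
  locallyIntegrable_k : LocallyIntegrableOn k (Ici 0)
  nonneg_k : ∀ t, 0 < t → 0 ≤ k t
  antitone_k : AntitoneOn k (Ioi 0)
  locallyIntegrable_l : LocallyIntegrableOn l (Ici 0)
  conv_eq_one : ∀ᵐ t : ℝ, 0 < t → halfLineConv k l t = 1

/-- The kernel `k` is of type `PC`. -/
def IsPC (k : ℝ → ℝ) : Prop := ∃ l : ℝ → ℝ, IsPCPair k l

/-- Laplace transform of a function on the half-line. -/
def laplace (f : ℝ → ℝ) (z : ℝ) : ℝ :=
  ∫ σ in Ioi (0 : ℝ), Real.exp (-z * σ) * f σ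

/-- `w = w(·, τ)` is the nondecreasing function in `BV(ℝ₊)`, normalized by `w 0 = 0` and
left-continuity, whose Laplace transform is `exp (-τ z k̂(z)) / z`. These requirements determine
`w` uniquely on `[0, ∞)`. -/
structure IsPropagationFunction (k : ℝ → ℝ) (τ : ℝ) (w : ℝ → ℝ) : Prop where
  monotone : MonotoneOn w (Ici 0)
  boundedVariation : BoundedVariationOn w (Ici 0)
  map_zero : w 0 = 0
  leftContinuous : ∀ t, 0 < t → ContinuousWithinAt w (Iic t) t
  laplace_eq : ∀ z, 0 < z → laplace w z = Real.exp (-τ * (z * laplace k z)) / z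

open Classical in
/-- The propagation function `w(t, τ)` of the kernel `k`, for `t, τ ≥ 0`. (The default value `0`
is only relevant when no function with the defining properties exists; for kernels of type `PC`
one exists for every `τ ≥ 0`.) -/
def propagation (k : ℝ → ℝ) (t τ : ℝ) : ℝ :=
  if h : ∃ w : ℝ → ℝ, IsPropagationFunction k τ w then h.choose t else 0

open Classical in
/-- The Lebesgue-Stieltjes measure `-d_τ w(t, τ)` on `[0, ∞)`, viewed as a measure on `ℝ`
(the function is continued to `τ < 0` by its value at `τ = 0`). For a kernel of type `PC` and
`t > 0` the function `w(t, ·)` is nonincreasing, so the first branch applies. -/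
def propagationMeasure (k : ℝ → ℝ) (t : ℝ) : Measure ℝ :=
  if h : Monotone (fun τ : ℝ => -propagation k t (max τ 0)) then h.stieltjesFunction.measure
  else 0

/-- The Gaussian heat kernel `H(τ, x) = (4πτ)^(-d/2) exp (-|x|² / (4τ))`, for `τ > 0`. -/
def heatKernel {d : ℕ} (τ : ℝ) (x : EuclideanSpace ℝ (Fin d)) : ℝ :=
  (4 * Real.pi * τ) ^ (-((d : ℝ) / 2)) * Real.exp (-‖x‖ ^ 2 / (4 * τ))

/-- The fundamental solution `Z(t, x) = -∫₀^∞ H(τ, x) d_τ w(t, τ)` of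
`∂ₜ (k * [u - u₀]) - Δ u = 0`, obtained from the heat kernel by subordination. -/
def fundamentalSolution {d : ℕ} (k : ℝ → ℝ) (t : ℝ) (x : EuclideanSpace ℝ (Fin d)) : ℝ :=
  ∫ τ in Ioi (0 : ℝ), heatKernel τ x ∂(propagationMeasure k t)

/-- The solution `u(t, x) = ∫ Z(t, x - y) u₀(y) dy`. -/
def solution {d : ℕ} (k : ℝ → ℝ) (u₀ : EuclideanSpace ℝ (Fin d) → ℂ) (t : ℝ)
    (x : EuclideanSpace ℝ (Fin d)) : ℂ :=
  ∫ y, fundamentalSolution k t (x - y) • u₀ y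

/-- The Fourier transform `ṽ(ξ) = ∫ exp (-i x·ξ) v(x) dx`. -/
def fourier {d : ℕ} (v : EuclideanSpace ℝ (Fin d) → ℂ) (ξ : EuclideanSpace ℝ (Fin d)) : ℂ :=
  ∫ x, Complex.exp (-Complex.I * ((inner ℝ x ξ : ℝ) : ℂ)) * v x

end Subdiffusion

end

noncomputable section

namespace Subdiffusion

open MeasureTheory Set Filter ProbabilityTheory
open scoped ENNReal Topology

/-! The lower bound comes from duality: u(t) is tested against a Gaussian H(b,·) whose scale b is
free. By subordination, u(t) is the initial datum convolved with the mixture of heat kernels H(τ,·)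
under the measure m = -d_τ w(t,τ). By the semigroup law, ∫ H(b,x) u(t,x) dx = ∫ S(y) u₀(y) dy with
S(y) = ∫ H(τ+b,y) dm(τ). For large b, S is nearly constant where u₀ has most of its mass, uniformly
in m, so the pairing is at least S(0) |∫ u₀| / 2, and ∫ u₀ is the Fourier transform at 0. Since
‖H(b,·)‖₂ ≤ (4πb)^(-d/4), Cauchy–Schwarz bounds ‖u(t)‖₂ from below (`le_eLpNorm_convolution`).

It remains to bound S(0) from below. The inequality 1 + τ/b ≤ e^(τ/b) gives S(0) ≥ (4πb)^(-d/2)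
s_μ(t) with μ = d/(2b), where s_μ(t) = ∫ e^(-μτ) dm(τ) is the relaxation function. It satisfies k *
d(1 - s) = μ s. As k is nonincreasing, the left side is at least k(t)(1 - s(t)), whence s ≥ k/(k +
μ) (`ae_div_le_relaxation`). Altogether ‖u(t)‖₂ ≥ c b^(-d/4) k/(k + d/(2b)) for all large b. A fixed
b yields the rate k, and b ~ 1/k yields k^(d/4); the better of the two has exponent min{1, d/4}.

All this needs the propagation function to exist and to be identified. It is the distribution
function of a sub-probability measure with Laplace transform exp(-τ z k̂(z)). For bounded k this is
a compound Poisson measure built from the jumps d(M - k); a general k is cut into layers of height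
one and the measures of the layers are convolved (`exists_isPropagationMeasure`). Uniqueness of
Laplace transforms (`eq_of_expTransform_eq`) identifies w and also proves the equation for s. -/

/-! ### Laplace transforms of measures on the half-line and their uniqueness. -/

/-- The Laplace transform `∫ exp (-z x) dκ(x)` of a measure on the real line. -/
def expTransform (κ : Measure ℝ) (z : ℝ) : ℝ≥0∞ :=
  ∫⁻ x, ENNReal.ofReal (Real.exp (-z * x)) ∂κ

theorem measurable_ofReal_exp (z : ℝ) :
    Measurable fun x : ℝ => ENNReal.ofReal (Real.exp (-z * x)) := by fun_prop

theorem expTransform_conv (κ ρ : Measure ℝ) [SFinite κ] [SFinite ρ] (z : ℝ) :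
    expTransform (κ ∗ ρ) z = expTransform κ z * expTransform ρ z := by
  unfold expTransform
  rw [Measure.lintegral_conv (measurable_ofReal_exp z)]
  have : ∀ x : ℝ, ∫⁻ y, ENNReal.ofReal (Real.exp (-z * (x + y))) ∂ρ
      = ENNReal.ofReal (Real.exp (-z * x)) * ∫⁻ y, ENNReal.ofReal (Real.exp (-z * y)) ∂ρ := by
    intro x
    rw [← lintegral_const_mul _ (measurable_ofReal_exp z)]
    refine lintegral_congr fun y => ?_
    rw [← ENNReal.ofReal_mul (Real.exp_nonneg _), ← Real.exp_add]
    ring_nf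
  simp_rw [this]
  rw [lintegral_mul_const _ (measurable_ofReal_exp z)]

/-- A finite measure on `[0, 1]`, given through a random variable, is determined by its
moments. -/
theorem complexMGF_eq_of_moments {κ ρ : Measure ℝ} [IsFiniteMeasure κ] [IsFiniteMeasure ρ]
    {Y : ℝ → ℝ} (hY : Measurable Y) (hκ : ∀ᵐ x ∂κ, |Y x| ≤ 1) (hρ : ∀ᵐ x ∂ρ, |Y x| ≤ 1)
    (h : ∀ n : ℕ, ∫ x, Y x ^ n ∂κ = ∫ x, Y x ^ n ∂ρ) :
    complexMGF Y κ = complexMGF Y ρ := by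
  -- As |Y| ≤ 1 and θ is finite, the exponential series may be integrated term by term, so the
  -- transform is a power series whose coefficients are the moments.
  have key : ∀ (θ : Measure ℝ) [IsFiniteMeasure θ], (∀ᵐ x ∂θ, |Y x| ≤ 1) → ∀ z : ℂ,
      HasSum (fun n : ℕ => (z ^ n / (n.factorial : ℂ)) * ((∫ x, Y x ^ n ∂θ : ℝ) : ℂ))
        (complexMGF Y θ z) := by
    intro θ _ hθ z
    let F : ℕ → ℝ → ℂ := fun n x => (z ^ n / (n.factorial : ℂ)) * ((Y x ^ n : ℝ) : ℂ)
    have hb : ∀ n, ∀ᵐ x ∂θ, ‖F n x‖ ≤ ‖z‖ ^ n / n.factorial := by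
      intro n
      filter_upwards [hθ] with x hx
      simp only [F, norm_mul, norm_div, norm_pow, Complex.norm_natCast, Complex.norm_real]
      refine mul_le_of_le_one_right (by positivity) (pow_le_one₀ (norm_nonneg _) hx)
    have hm : ∀ n, Measurable (F n) := by
      intro n; exact (Complex.measurable_ofReal.comp (hY.pow_const n)).const_mul _
    have hi : ∀ n, Integrable (F n) θ := fun n =>
      Integrable.of_bound (hm n).aestronglyMeasurable _ (hb n)
    have hs : Summable fun n => ∫ x, ‖F n x‖ ∂θ := by
      refine Summable.of_nonneg_of_le (fun n => integral_nonneg fun x => norm_nonneg _) (fun n => ?_)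
        ((Real.summable_pow_div_factorial ‖z‖).mul_right (θ.real univ))
      calc ∫ x, ‖F n x‖ ∂θ ≤ ∫ x, ‖z‖ ^ n / n.factorial ∂θ :=
            integral_mono_ae (hi n).norm (integrable_const _) (hb n)
        _ = _ := by simp [mul_comm]
    have := hasSum_integral_of_summable_integral_norm hi hs
    have hF : ∀ n, ∫ x, F n x ∂θ
        = (z ^ n / (n.factorial : ℂ)) * ((∫ x, Y x ^ n ∂θ : ℝ) : ℂ) := fun n => by
      rw [integral_const_mul, ← integral_complex_ofReal]
    simp_rw [hF] at this
    convert! this using 1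
    · unfold complexMGF
      refine integral_congr_ae (Eventually.of_forall fun x => ?_)
      simp only [F, Complex.exp_eq_exp_ℂ]
      rw [NormedSpace.exp_eq_tsum_div]
      refine tsum_congr fun n => ?_
      push_cast
      rw [mul_pow]; ring
  ext z
  have h1 := key κ hκ z
  simp_rw [h] at h1
  exact h1.unique (key ρ hρ z)

theorem ae_nonneg_of_Iio {κ : Measure ℝ} (hκ : κ (Iio 0) = 0) : ∀ᵐ x ∂κ, 0 ≤ x := by
  rw [ae_iff]
  convert hκ using 2
  ext x; simp

/-- A measure on `[0, ∞)` is determined by its Laplace transform. -/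
theorem eq_of_expTransform_eq {κ ρ : Measure ℝ} (hκ : κ (Iio 0) = 0) (hρ : ρ (Iio 0) = 0)
    (hfin : ∀ z, 0 < z → expTransform κ z ≠ ∞)
    (h : ∀ z, 0 < z → expTransform κ z = expTransform ρ z) : κ = ρ := by
  -- The map x ↦ e^(-x) carries the half-line into (0, 1]. The weight e^(-x) makes the measures
  -- finite, and the n-th moment of Y becomes the Laplace transform at n + 1.
  let Y : ℝ → ℝ := fun x => Real.exp (-x)
  let q : ℝ → ℝ≥0∞ := fun x => ENNReal.ofReal (Real.exp (-1 * x))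
  have hq : Measurable q := measurable_ofReal_exp 1
  have hY : Measurable Y := by fun_prop
  have hYe : MeasurableEmbedding Y :=
    (Real.continuous_exp.comp continuous_neg).measurableEmbedding
      (Real.exp_injective.comp neg_injective)
  have hfκ : IsFiniteMeasure (κ.withDensity q) :=
    isFiniteMeasure_withDensity (hfin 1 one_pos)
  have hfρ : IsFiniteMeasure (ρ.withDensity q) :=
    isFiniteMeasure_withDensity (by rw [← expTransform, ← h 1 one_pos]; exact hfin 1 one_pos)
  have hab : ∀ θ : Measure ℝ, θ (Iio 0) = 0 → ∀ᵐ x ∂(θ.withDensity q), |Y x| ≤ 1 := by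
    intro θ hθ
    refine (withDensity_absolutelyContinuous θ q).ae_le ?_
    filter_upwards [ae_nonneg_of_Iio hθ] with x hx
    rw [abs_of_nonneg (Real.exp_nonneg _)]
    exact Real.exp_le_one_iff.2 (by linarith)
  have hmom : ∀ θ : Measure ℝ, ∀ n : ℕ,
      ∫ x, Y x ^ n ∂(θ.withDensity q) = (expTransform θ (n + 1)).toReal := by
    intro θ n
    rw [integral_eq_lintegral_of_nonneg_ae (Eventually.of_forall fun x => by positivity)
      (hY.pow_const n).aestronglyMeasurable,
      lintegral_withDensity_eq_lintegral_mul _ hq (by fun_prop)]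
    unfold expTransform
    congr 1
    refine lintegral_congr fun x => ?_
    simp only [q, Y, Pi.mul_apply]
    rw [← ENNReal.ofReal_mul (Real.exp_nonneg _), ← Real.exp_nat_mul, ← Real.exp_add]
    ring_nf
  have hmgf := complexMGF_eq_of_moments (κ := κ.withDensity q) (ρ := ρ.withDensity q) hY
    (hab κ hκ) (hab ρ hρ) (fun n => by rw [hmom, hmom, h _ (by positivity)])
  have hmap := Measure.ext_of_complexMGF_eq hY.aemeasurable hY.aemeasurable hmgf
  have hd : κ.withDensity q = ρ.withDensity q := by
    rw [← hYe.comap_map (κ.withDensity q), hmap, hYe.comap_map]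
  -- The weight is positive and finite, hence can be divided out again.
  have h0 : ∀ x, q x ≠ 0 := fun x => by simp [q, Real.exp_pos]
  have ht : ∀ x, q x ≠ ∞ := fun x => by simp [q]
  rw [← withDensity_inv_same (μ := κ) hq (Eventually.of_forall h0) (Eventually.of_forall ht), hd,
    withDensity_inv_same hq (Eventually.of_forall h0) (Eventually.of_forall ht)]

theorem lintegral_Ioi_exp {z : ℝ} (hz : 0 < z) (x : ℝ) :
    ∫⁻ σ in Ioi x, ENNReal.ofReal (z * Real.exp (-z * σ)) = ENNReal.ofReal (Real.exp (-z * x)) := by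
  rw [← ofReal_integral_eq_lintegral_ofReal]
  · rw [integral_const_mul, integral_exp_mul_Ioi (by linarith)]
    congr 1; field_simp
  · exact (integrableOn_exp_mul_Ioi (by linarith) x).const_mul z
  · exact Eventually.of_forall fun σ => by positivity

/-- Integration by parts for the Laplace transform of a measure on `[0, ∞)`. -/
theorem expTransform_eq_lintegral_Iio {κ : Measure ℝ} [SFinite κ] (hκ : κ (Iio 0) = 0) {z : ℝ}
    (hz : 0 < z) :
    expTransform κ z = ∫⁻ σ in Ioi 0, ENNReal.ofReal (z * Real.exp (-z * σ)) * κ (Iio σ) := by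
  -- For x ≥ 0, write e^(-zx) as the integral of z e^(-zσ) over σ > x; Tonelli on {x < σ} then
  -- produces κ([0, σ)).
  have h1 : expTransform κ z = ∫⁻ x, (∫⁻ σ in Ioi (0 : ℝ),
      {p : ℝ × ℝ | p.1 < p.2}.indicator
        (fun p => ENNReal.ofReal (z * Real.exp (-z * p.2))) (x, σ)) ∂κ := by
    unfold expTransform
    refine lintegral_congr_ae ?_
    filter_upwards [ae_nonneg_of_Iio hκ] with x hx
    rw [← lintegral_Ioi_exp hz, ← lintegral_indicator measurableSet_Ioi,
      ← lintegral_indicator measurableSet_Ioi]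
    refine lintegral_congr fun σ => ?_
    by_cases h : x < σ
    · simp [h, hx.trans_lt h]
    · simp [indicator, h]
  have hm : Measurable ({p : ℝ × ℝ | p.1 < p.2}.indicator
      (fun p => ENNReal.ofReal (z * Real.exp (-z * p.2)))) :=
    Measurable.indicator (by fun_prop) (measurableSet_lt measurable_fst measurable_snd)
  rw [h1, lintegral_lintegral_swap (f := fun x σ => {p : ℝ × ℝ | p.1 < p.2}.indicator
        (fun p => ENNReal.ofReal (z * Real.exp (-z * p.2))) (x, σ)) hm.aemeasurable]
  refine lintegral_congr fun σ => ?_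
  have : ∀ x, {p : ℝ × ℝ | p.1 < p.2}.indicator
        (fun p => ENNReal.ofReal (z * Real.exp (-z * p.2))) (x, σ)
      = (Iio σ).indicator (fun _ => ENNReal.ofReal (z * Real.exp (-z * σ))) x := by
    intro x
    by_cases h : x < σ <;> simp [h]
  simp_rw [this]
  rw [lintegral_indicator measurableSet_Iio, lintegral_const, Measure.restrict_apply_univ]

/-! ### Stieltjes measures of monotone functions constant on the negative half-line. -/

theorem tendsto_stieltjesFunction_atBot {F : ℝ → ℝ} (hF : Monotone F) {A : ℝ}
    (hA : ∀ x < 0, F x = A) : Tendsto hF.stieltjesFunction atBot (𝓝 A) := by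
  refine tendsto_const_nhds.congr' ?_
  filter_upwards [eventually_lt_atBot (0 : ℝ)] with x hx
  rw [hF.stieltjesFunction_eq]
  refine le_antisymm ?_ ?_
  · rw [← hA x hx]; exact hF.le_rightLim le_rfl
  · rw [← hA (x / 2) (by linarith)]; exact hF.rightLim_le (by linarith)

theorem stieltjes_Iio_zero {F : ℝ → ℝ} (hF : Monotone F) {A : ℝ}
    (hA : ∀ x < 0, F x = A) : hF.stieltjesFunction.measure (Iio 0) = 0 := by
  rw [StieltjesFunction.measure_Iio _ (tendsto_stieltjesFunction_atBot hF hA)]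
  refine ENNReal.ofReal_eq_zero.2 (sub_nonpos.2 ?_)
  have : (𝓝[<] (0 : ℝ)).NeBot := inferInstance
  refine le_of_tendsto (hF.stieltjesFunction.mono.tendsto_leftLim 0) ?_
  filter_upwards [self_mem_nhdsWithin] with x (hx : x < 0)
  rw [hF.stieltjesFunction_eq, ← hA (x / 2) (by linarith)]
  exact hF.rightLim_le (by linarith)

/-- The Stieltjes function is the right-continuous modification of F, but it has the same left
limits as F; left continuity at t therefore recovers the value F t itself. -/
theorem stieltjes_Iio {F : ℝ → ℝ} (hF : Monotone F) {A : ℝ} (hA : ∀ x < 0, F x = A)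
    {t : ℝ} (ht : ContinuousWithinAt F (Iio t) t) :
    hF.stieltjesFunction.measure (Iio t) = ENNReal.ofReal (F t - A) := by
  rw [StieltjesFunction.measure_Iio _ (tendsto_stieltjesFunction_atBot hF hA)]
  congr 2
  refine le_antisymm ?_ ?_
  · refine le_of_tendsto (hF.stieltjesFunction.mono.tendsto_leftLim t) ?_
    filter_upwards [self_mem_nhdsWithin] with x (hx : x < t)
    rw [hF.stieltjesFunction_eq]
    exact hF.rightLim_le hx
  · refine le_of_tendsto ht ?_
    filter_upwards [self_mem_nhdsWithin] with x (hx : x < t)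
    calc F x ≤ hF.stieltjesFunction x := by
          rw [hF.stieltjesFunction_eq]; exact hF.le_rightLim le_rfl
      _ ≤ _ := hF.stieltjesFunction.mono.le_leftLim hx

theorem ae_continuousAt_of_monotone {F : ℝ → ℝ} (hF : Monotone F) :
    ∀ᵐ t : ℝ, ContinuousAt F t := by
  rw [ae_iff]
  exact hF.countable_not_continuousAt.measure_zero _

theorem stieltjes_univ_le {F : ℝ → ℝ} (hF : Monotone F) {A C : ℝ} (hA : ∀ x < 0, F x = A)
    (hC : ∀ x, F x ≤ C) : hF.stieltjesFunction.measure univ ≤ ENNReal.ofReal (C - A) := by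
  have hm : Monotone fun n : ℕ => Iic (n : ℝ) := fun a b hab => Iic_subset_Iic.2 (by exact_mod_cast hab)
  have hu : (⋃ n : ℕ, Iic (n : ℝ)) = univ := by
    ext x; simpa using exists_nat_ge x
  rw [← hu, hm.measure_iUnion]
  refine iSup_le fun n => ?_
  rw [StieltjesFunction.measure_Iic _ (tendsto_stieltjesFunction_atBot hF hA)]
  refine ENNReal.ofReal_le_ofReal (sub_le_sub_right ?_ _)
  rw [hF.stieltjesFunction_eq]
  exact (hF.rightLim_le (lt_add_one (n : ℝ))).trans (hC _)

/-- The Laplace transform of a Stieltjes measure. -/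
theorem expTransform_stieltjes {F : ℝ → ℝ} (hF : Monotone F) {A : ℝ} (hA : ∀ x < 0, F x = A)
    {z : ℝ} (hz : 0 < z) :
    expTransform hF.stieltjesFunction.measure z
      = ∫⁻ σ in Ioi 0, ENNReal.ofReal (z * Real.exp (-z * σ)) * ENNReal.ofReal (F σ - A) := by
  rw [expTransform_eq_lintegral_Iio (stieltjes_Iio_zero hF hA) hz]
  refine lintegral_congr_ae (ae_restrict_of_ae ?_)
  filter_upwards [ae_continuousAt_of_monotone hF] with t ht
  rw [stieltjes_Iio hF hA ht.continuousWithinAt]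

/-! ### Convolution powers and compound Poisson measures for bounded kernels. -/

/-- If x ≥ 0 and x + y < t then y < t. Consequently convolving with a sub-probability measure on the
half-line lowers the distribution function, which gives both the decreasing limit over the layers of
k and the monotonicity of w in τ. -/
theorem conv_Iio_le {κ ρ : Measure ℝ} [SFinite κ] [SFinite ρ] (hρ : ρ (Iio 0) = 0) (t : ℝ) :
    (κ ∗ ρ) (Iio t) ≤ κ (Iio t) * ρ univ := by
  have hm : Measurable ((Iio t).indicator fun _ : ℝ => (1 : ℝ≥0∞)) :=
    measurable_const.indicator measurableSet_Iio
  rw [Measure.conv_comm, ← lintegral_indicator_one measurableSet_Iio]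
  erw [Measure.lintegral_conv hm]
  rw [← lintegral_const]
  refine lintegral_mono_ae ?_
  filter_upwards [ae_nonneg_of_Iio hρ] with x hx
  rw [← lintegral_indicator_one measurableSet_Iio]
  refine lintegral_mono fun y => ?_
  by_cases h : x + y < t
  · have : y < t := by linarith
    simp [h, this]
  · simp [h]

theorem conv_Iio_zero {κ ρ : Measure ℝ} [SFinite κ] [SFinite ρ] (hκ : κ (Iio 0) = 0)
    (hρ : ρ (Iio 0) = 0) : (κ ∗ ρ) (Iio 0) = 0 := by
  simpa [hκ] using conv_Iio_le (κ := κ) hρ 0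

theorem expTransform_zero (κ : Measure ℝ) : expTransform κ 0 = κ univ := by
  simp [expTransform]

/-- Convolution powers of a measure. -/
def convPow (κ : Measure ℝ) : ℕ → Measure ℝ
  | 0 => Measure.dirac 0
  | n + 1 => convPow κ n ∗ κ

instance isFiniteMeasure_convPow (κ : Measure ℝ) [IsFiniteMeasure κ] (n : ℕ) :
    IsFiniteMeasure (convPow κ n) := by
  induction n with
  | zero => unfold convPow; infer_instance
  | succ n ih => unfold convPow; infer_instance

theorem convPow_Iio_zero {κ : Measure ℝ} [IsFiniteMeasure κ] (hκ : κ (Iio 0) = 0) (n : ℕ) :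
    convPow κ n (Iio 0) = 0 := by
  induction n with
  | zero => simp [convPow]
  | succ n ih => exact conv_Iio_zero ih hκ

theorem expTransform_convPow (κ : Measure ℝ) [IsFiniteMeasure κ] (n : ℕ) (z : ℝ) :
    expTransform (convPow κ n) z = expTransform κ z ^ n := by
  induction n with
  | zero => simp [convPow, expTransform]
  | succ n ih => rw [convPow, expTransform_conv, ih, pow_succ]

/-- The compound Poisson measure `exp (τ (κ - M δ₀))`. -/
def compoundPoisson (κ : Measure ℝ) (M τ : ℝ) : Measure ℝ :=
  Measure.sum fun n : ℕ =>
    ENNReal.ofReal (Real.exp (-τ * M) * (τ ^ n / n.factorial)) • convPow κ n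

theorem expTransform_compoundPoisson (κ : Measure ℝ) [IsFiniteMeasure κ] (M : ℝ) {τ : ℝ}
    (hτ : 0 ≤ τ) {z a : ℝ} (ha : 0 ≤ a) (h : expTransform κ z = ENNReal.ofReal a) :
    expTransform (compoundPoisson κ M τ) z = ENNReal.ofReal (Real.exp (-τ * (M - a))) := by
  unfold compoundPoisson
  rw [expTransform, lintegral_sum_measure]
  have : ∀ n : ℕ, ∫⁻ x, ENNReal.ofReal (Real.exp (-z * x))
      ∂(ENNReal.ofReal (Real.exp (-τ * M) * (τ ^ n / n.factorial)) • convPow κ n)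
      = ENNReal.ofReal (Real.exp (-τ * M) * ((τ * a) ^ n / n.factorial)) := by
    intro n
    rw [lintegral_smul_measure, ← expTransform, expTransform_convPow, h, smul_eq_mul,
      ← ENNReal.ofReal_pow ha, ← ENNReal.ofReal_mul (by positivity)]
    congr 1
    rw [mul_pow]; ring
  simp_rw [this]
  rw [← ENNReal.ofReal_tsum_of_nonneg (fun n => by positivity)
    ((Real.summable_pow_div_factorial _).mul_left _), tsum_mul_left]
  congr 1
  rw [show -τ * (M - a) = -τ * M + τ * a by ring, Real.exp_add, Real.exp_eq_exp_ℝ,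
    NormedSpace.exp_eq_tsum_div]

theorem aestronglyMeasurable_of_antitoneOn {h : ℝ → ℝ} (ha : AntitoneOn h (Ioi 0)) :
    AEStronglyMeasurable h (volume.restrict (Ioi 0)) :=
  (aemeasurable_restrict_of_antitoneOn measurableSet_Ioi ha).aestronglyMeasurable

theorem integrableOn_exp_mul_of_bounded {f : ℝ → ℝ}
    (hf : AEStronglyMeasurable f (volume.restrict (Ioi 0))) {C : ℝ}
    (hC : ∀ t, 0 < t → |f t| ≤ C) {z : ℝ} (hz : 0 < z) :
    IntegrableOn (fun σ => Real.exp (-z * σ) * f σ) (Ioi 0) := by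
  refine Integrable.mul_bdd (c := C) (integrableOn_exp_mul_Ioi (by linarith) 0) hf ?_
  filter_upwards [ae_restrict_mem measurableSet_Ioi] with t ht using hC t ht

theorem laplace_one {z : ℝ} (hz : 0 < z) : laplace (fun _ => 1) z = 1 / z := by
  unfold laplace
  simp only [mul_one]
  rw [integral_exp_mul_Ioi (by linarith)]
  simp [neg_div_neg_eq]

/-- For a bounded kernel `h`, `exp (-τ z ĥ(z))` is the Laplace transform of a sub-probability
measure. -/
theorem exists_measure_of_bounded {h : ℝ → ℝ} {M : ℝ} (h0 : ∀ t, 0 < t → 0 ≤ h t)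
    (hM : ∀ t, 0 < t → h t ≤ M) (ha : AntitoneOn h (Ioi 0)) {τ : ℝ} (hτ : 0 ≤ τ) :
    ∃ ν : Measure ℝ, ν (Iio 0) = 0 ∧ ν univ ≤ 1 ∧
      ∀ z, 0 < z → expTransform ν z = ENNReal.ofReal (Real.exp (-τ * (z * laplace h z))) := by
  -- Since h is nonincreasing and lies between 0 and M, F is nondecreasing. Its Stieltjes measure κ
  -- has mass at most M, may have an atom M - h(0+) at 0, and has transform M - z ĥ(z). Thus exp(τ(κ
  -- - M δ₀)) has the required transform.
  let F : ℝ → ℝ := fun t => if t ≤ 0 then 0 else M - h t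
  have hM0 : 0 ≤ M := (h0 1 one_pos).trans (hM 1 one_pos)
  have hF : Monotone F := by
    intro s t hst
    simp only [F]
    split_ifs with h1 h2 h2
    · exact le_rfl
    · linarith [hM t (by linarith)]
    · linarith
    · have := ha (show s ∈ Ioi 0 from not_le.1 h1) (show t ∈ Ioi 0 from not_le.1 h2) hst
      linarith
  have hFA : ∀ x < 0, F x = 0 := fun x hx => by simp [F, hx.le]
  have hFC : ∀ x, F x ≤ M := by
    intro x
    simp only [F]
    split_ifs with h1
    · exact hM0
    · linarith [h0 x (not_le.1 h1)]
  set κ := hF.stieltjesFunction.measure with hκ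
  have hκu : κ univ ≤ ENNReal.ofReal M := by simpa using stieltjes_univ_le hF hFA hFC
  have : IsFiniteMeasure κ := ⟨hκu.trans_lt ENNReal.ofReal_lt_top⟩
  have hT : ∀ z, 0 < z → 0 ≤ M - z * laplace h z ∧
      expTransform κ z = ENNReal.ofReal (M - z * laplace h z) := by
    intro z hz
    have hi1 : IntegrableOn (fun σ => Real.exp (-z * σ) * 1) (Ioi 0) := by
      simpa using integrableOn_exp_mul_Ioi (a := -z) (by linarith) 0
    have hi2 : IntegrableOn (fun σ => Real.exp (-z * σ) * h σ) (Ioi 0) :=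
      integrableOn_exp_mul_of_bounded (aestronglyMeasurable_of_antitoneOn ha) (C := M)
        (fun t ht => by rw [abs_of_nonneg (h0 t ht)]; exact hM t ht) hz
    have he : M - z * laplace h z
        = ∫ σ in Ioi 0, ((z * M) * (Real.exp (-z * σ) * 1) - z * (Real.exp (-z * σ) * h σ)) := by
      rw [integral_sub (hi1.const_mul _) (hi2.const_mul _), integral_const_mul,
        integral_const_mul]
      have := laplace_one hz
      unfold laplace at this ⊢
      rw [this]; field_simp
    have hp : ∀ᵐ σ ∂(volume.restrict (Ioi (0 : ℝ))),
        0 ≤ (z * M) * (Real.exp (-z * σ) * 1) - z * (Real.exp (-z * σ) * h σ) := by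
      filter_upwards [ae_restrict_mem measurableSet_Ioi] with t ht
      have : 0 ≤ z * Real.exp (-z * t) * (M - h t) :=
        mul_nonneg (by positivity) (by linarith [hM t ht])
      linarith
    refine ⟨he ▸ integral_nonneg_of_ae hp, ?_⟩
    have hi : Integrable (fun σ => (z * M) * (Real.exp (-z * σ) * 1)
        - z * (Real.exp (-z * σ) * h σ)) (volume.restrict (Ioi 0)) :=
      (hi1.const_mul _).sub (hi2.const_mul _)
    rw [hκ, expTransform_stieltjes hF hFA hz, he, ofReal_integral_eq_lintegral_ofReal hi hp]
    refine lintegral_congr_ae ?_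
    filter_upwards [ae_restrict_mem measurableSet_Ioi] with t ht
    rw [← ENNReal.ofReal_mul (by positivity)]
    congr 1
    simp only [F, not_le.2 (mem_Ioi.1 ht), if_false]
    ring
  refine ⟨compoundPoisson κ M τ, ?_, ?_, ?_⟩
  · unfold compoundPoisson
    rw [Measure.sum_apply _ measurableSet_Iio]
    have h0 : ∀ n, convPow κ n (Iio 0) = 0 := convPow_Iio_zero (stieltjes_Iio_zero hF hFA)
    simp [h0]
  -- The total mass is the transform at 0, namely exp(-τ(M - κ(ℝ))), and κ(ℝ) ≤ M.
  · rw [← expTransform_zero, expTransform_compoundPoisson κ M hτ (a := (κ univ).toReal)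
      ENNReal.toReal_nonneg
      (by rw [expTransform_zero, ENNReal.ofReal_toReal (measure_ne_top _ _)])]
    rw [ENNReal.ofReal_le_one]
    have : (κ univ).toReal ≤ M := ENNReal.toReal_le_of_le_ofReal hM0 hκu
    exact Real.exp_le_one_iff.2 (by nlinarith)
  · intro z hz
    rw [expTransform_compoundPoisson κ M hτ (hT z hz).1 (hT z hz).2]
    simp

/-! ### Existence of propagation measures for general kernels. -/

/-- A sub-probability measure on `[0, ∞)` whose Laplace transform is `exp (-τ z k̂(z))`. -/
structure IsPropagationMeasure (k : ℝ → ℝ) (τ : ℝ) (ν : Measure ℝ) : Prop where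
  Iio_zero : ν (Iio 0) = 0
  univ_le : ν univ ≤ 1
  transform : ∀ z, 0 < z →
    expTransform ν z = ENNReal.ofReal (Real.exp (-τ * (z * laplace k z)))

theorem IsPropagationMeasure.isFiniteMeasure {k : ℝ → ℝ} {τ : ℝ} {ν : Measure ℝ}
    (h : IsPropagationMeasure k τ ν) : IsFiniteMeasure ν :=
  ⟨h.univ_le.trans_lt ENNReal.one_lt_top⟩

theorem conv_univ (κ ρ : Measure ℝ) [SFinite κ] [SFinite ρ] :
    (κ ∗ ρ) univ = κ univ * ρ univ := by
  simpa [expTransform_zero] using expTransform_conv κ ρ 0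

/-- Propagation measures multiply under convolution, in the form needed for sums of kernels and
for the semigroup law. -/
theorem IsPropagationMeasure.conv {k₁ k₂ k : ℝ → ℝ} {τ₁ τ₂ τ : ℝ} {ν₁ ν₂ : Measure ℝ}
    (h₁ : IsPropagationMeasure k₁ τ₁ ν₁) (h₂ : IsPropagationMeasure k₂ τ₂ ν₂)
    (h : ∀ z, 0 < z → τ * laplace k z = τ₁ * laplace k₁ z + τ₂ * laplace k₂ z) :
    IsPropagationMeasure k τ (ν₁ ∗ ν₂) := by
  have := h₁.isFiniteMeasure
  have := h₂.isFiniteMeasure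
  refine ⟨conv_Iio_zero h₁.Iio_zero h₂.Iio_zero, ?_, fun z hz => ?_⟩
  · rw [conv_univ]
    exact mul_le_one' h₁.univ_le h₂.univ_le
  · rw [expTransform_conv, h₁.transform z hz, h₂.transform z hz,
      ← ENNReal.ofReal_mul (Real.exp_nonneg _), ← Real.exp_add]
    congr 2
    linear_combination z * h z hz

/-- The pointwise limit of a decreasing sequence of distribution functions of propagation
measures is the distribution function of a propagation measure. -/
theorem exists_isPropagationMeasure_of_tendsto {k : ℝ → ℝ} {τ : ℝ} {kn : ℕ → ℝ → ℝ}
    {θ : ℕ → Measure ℝ} (hθ : ∀ n, IsPropagationMeasure (kn n) τ (θ n))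
    (hanti : ∀ t, Antitone fun n => θ n (Iio t))
    (hlim : ∀ z, 0 < z → Tendsto (fun n => laplace (kn n) z) atTop (𝓝 (laplace k z))) :
    ∃ ν, IsPropagationMeasure k τ ν := by
  -- The infimum need not be left-continuous. This is harmless: the transform of its Stieltjes
  -- measure depends only on its values almost everywhere.
  let W : ℝ → ℝ≥0∞ := fun t => ⨅ n, θ n (Iio t)
  have hW1 : ∀ t, W t ≤ 1 := fun t =>
    (iInf_le _ 0).trans ((measure_mono (subset_univ _)).trans (hθ 0).univ_le)
  have hWt : ∀ t, W t ≠ ∞ := fun t => ((hW1 t).trans_lt ENNReal.one_lt_top).ne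
  let F : ℝ → ℝ := fun t => (W t).toReal
  have hF : Monotone F := fun s t hst =>
    ENNReal.toReal_mono (hWt t) (iInf_mono fun n => measure_mono (Iio_subset_Iio hst))
  have hFA : ∀ x < 0, F x = 0 := by
    intro x hx
    have : W x = 0 := le_antisymm ((iInf_le _ 0).trans
      ((measure_mono (Iio_subset_Iio hx.le)).trans (hθ 0).Iio_zero.le)) zero_le
    simp [F, this]
  have hFC : ∀ x, F x ≤ 1 := fun x => ENNReal.toReal_le_of_le_ofReal zero_le_one (by simpa using hW1 x)
  refine ⟨hF.stieltjesFunction.measure, stieltjes_Iio_zero hF hFA,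
    by simpa using stieltjes_univ_le hF hFA hFC, fun z hz => ?_⟩
  rw [expTransform_stieltjes hF hFA hz]
  have e1 : ∀ σ, ENNReal.ofReal (F σ - 0) = W σ := fun σ => by
    simp [F, ENNReal.ofReal_toReal (hWt σ)]
  simp_rw [e1]
  have l1 : Tendsto (fun n => ∫⁻ σ in Ioi 0, ENNReal.ofReal (z * Real.exp (-z * σ)) * θ n (Iio σ))
      atTop (𝓝 (∫⁻ σ in Ioi 0, ENNReal.ofReal (z * Real.exp (-z * σ)) * W σ)) := by
    refine tendsto_lintegral_of_dominated_convergence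
      (fun σ => ENNReal.ofReal (z * Real.exp (-z * σ))) (fun n => ?_) (fun n => ?_) ?_ ?_
    · refine Measurable.mul (by fun_prop) (Monotone.measurable fun s t hst => ?_)
      exact measure_mono (Iio_subset_Iio hst)
    · refine Eventually.of_forall fun σ => mul_le_of_le_one_right' ?_
      exact (measure_mono (subset_univ _)).trans (hθ n).univ_le
    · rw [lintegral_Ioi_exp hz]; exact ENNReal.ofReal_ne_top
    · refine Eventually.of_forall fun σ => ENNReal.Tendsto.const_mul
        (tendsto_atTop_iInf (hanti σ)) (Or.inr ENNReal.ofReal_ne_top)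
  have e2 : ∀ n, ∫⁻ σ in Ioi 0, ENNReal.ofReal (z * Real.exp (-z * σ)) * θ n (Iio σ)
      = ENNReal.ofReal (Real.exp (-τ * (z * laplace (kn n) z))) := by
    intro n
    have := (hθ n).isFiniteMeasure
    rw [← expTransform_eq_lintegral_Iio (hθ n).Iio_zero hz, (hθ n).transform z hz]
  simp_rw [e2] at l1
  refine tendsto_nhds_unique l1 (ENNReal.tendsto_ofReal ?_)
  exact (Real.continuous_exp.tendsto _).comp (((hlim z hz).const_mul z).const_mul (-τ))

/-- Nonnegative nonincreasing kernels on the half-line with a Laplace transform. -/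
structure IsDecreasingKernel (k : ℝ → ℝ) : Prop where
  nonneg : ∀ t, 0 < t → 0 ≤ k t
  antitone : AntitoneOn k (Ioi 0)
  integrable : ∀ z, 0 < z → IntegrableOn (fun σ => Real.exp (-z * σ) * k σ) (Ioi 0)

/-- Convolution of the first `n` measures of a sequence. -/
def convProd (ρ : ℕ → Measure ℝ) : ℕ → Measure ℝ
  | 0 => Measure.dirac 0
  | n + 1 => convProd ρ n ∗ ρ n

/-- The kernel is the sum of the layers min(k, n+1) - min(k, n), each nonincreasing with values in
[0, 1]. Each layer has a compound Poisson measure, and convolution adds the exponents. Every further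
factor lowers the distribution function, so the partial products converge, while the transforms of
min(k, n) converge to that of k by domination. -/
theorem exists_isPropagationMeasure {k : ℝ → ℝ} (hk : IsDecreasingKernel k) {τ : ℝ}
    (hτ : 0 ≤ τ) : ∃ ν, IsPropagationMeasure k τ ν := by
  let kn : ℕ → ℝ → ℝ := fun n t => min (k t) n
  let hn : ℕ → ℝ → ℝ := fun n t => min (k t) (n + 1 : ℕ) - min (k t) n
  -- A layer is a nondecreasing function of the value of k, so it inherits the monotonicity of k in
  -- t.
  have hcl : ∀ (n : ℕ) (x y : ℝ), x ≤ y →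
      min x (n + 1 : ℕ) - min x n ≤ min y (n + 1 : ℕ) - min y n := by
    intro n x y hxy
    push_cast
    rcases min_cases x (n + 1 : ℝ) with h1 | h1 <;> rcases min_cases x (n : ℝ) with h2 | h2 <;>
    rcases min_cases y (n + 1 : ℝ) with h3 | h3 <;> rcases min_cases y (n : ℝ) with h4 | h4 <;>
    linarith
  have hb0 : ∀ n t, 0 < t → 0 ≤ hn n t := fun n t ht =>
    sub_nonneg.2 (min_le_min le_rfl (by push_cast; linarith))
  have hb1 : ∀ n t, 0 < t → hn n t ≤ 1 := by
    intro n t ht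
    simp only [hn]
    push_cast
    rcases min_cases (k t) (n + 1 : ℝ) with h1 | h1 <;> rcases min_cases (k t) (n : ℝ) with h2 | h2 <;>
    linarith
  have hba : ∀ n, AntitoneOn (hn n) (Ioi 0) := fun n s hs t ht hst =>
    hcl n _ _ (hk.antitone hs ht hst)
  have hkm := aestronglyMeasurable_of_antitoneOn hk.antitone
  have hknm : ∀ n, AEStronglyMeasurable (kn n) (volume.restrict (Ioi 0)) := fun n =>
    (hkm.aemeasurable.min aemeasurable_const).aestronglyMeasurable
  choose ρ hρ using fun n => exists_measure_of_bounded (hb0 n) (hb1 n) (hba n) hτ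
  have hρ' : ∀ n, IsPropagationMeasure (hn n) τ (ρ n) := fun n =>
    ⟨(hρ n).1, (hρ n).2.1, (hρ n).2.2⟩
  have hlin : ∀ n z, 0 < z → laplace (kn (n + 1)) z = laplace (kn n) z + laplace (hn n) z := by
    intro n z hz
    unfold laplace
    rw [← integral_add]
    · refine integral_congr_ae (Eventually.of_forall fun σ => ?_)
      simp only [kn, hn]; ring
    · refine integrableOn_exp_mul_of_bounded (hknm n) (C := n) (fun t ht => ?_) hz
      rw [abs_of_nonneg (le_min (hk.nonneg t ht) (Nat.cast_nonneg n))]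
      exact min_le_right _ _
    · refine integrableOn_exp_mul_of_bounded (aestronglyMeasurable_of_antitoneOn (hba n)) (C := 1)
        (fun t ht => ?_) hz
      rw [abs_of_nonneg (hb0 n t ht)]
      exact hb1 n t ht
  have hθ : ∀ n, IsPropagationMeasure (kn n) τ (convProd ρ n) := by
    intro n
    induction n with
    | zero =>
      refine ⟨by simp [convProd], by simp [convProd], fun z hz => ?_⟩
      have : laplace (kn 0) z = 0 := by
        unfold laplace
        rw [setIntegral_congr_fun (g := fun _ => 0) measurableSet_Ioi, integral_zero]
        intro σ hσ
        simp [kn, hk.nonneg σ hσ]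
      simp [convProd, expTransform, this]
    | succ n ih =>
      exact ih.conv (hρ' n) fun z hz => by rw [hlin n z hz]; ring
  refine exists_isPropagationMeasure_of_tendsto hθ (fun t => antitone_nat_of_succ_le fun n => ?_)
    (fun z hz => ?_)
  · have := (hθ n).isFiniteMeasure
    have := (hρ' n).isFiniteMeasure
    exact (conv_Iio_le (hρ' n).Iio_zero t).trans (mul_le_of_le_one_right' (hρ' n).univ_le)
  · refine tendsto_integral_of_dominated_convergence (fun σ => Real.exp (-z * σ) * k σ)
      (fun n => ?_) (hk.integrable z hz) (fun n => ?_) ?_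
    · exact AEStronglyMeasurable.mul (by fun_prop) (hknm n)
    · filter_upwards [ae_restrict_mem measurableSet_Ioi] with t ht
      have h1 : 0 ≤ kn n t := le_min (hk.nonneg t ht) (Nat.cast_nonneg n)
      rw [Real.norm_of_nonneg (by positivity)]
      exact mul_le_mul_of_nonneg_left (min_le_left _ _) (Real.exp_nonneg _)
    · filter_upwards with t
      refine tendsto_const_nhds.congr' ?_
      obtain ⟨N, hN⟩ := exists_nat_ge (k t)
      filter_upwards [eventually_ge_atTop N] with n hnN
      have : k t ≤ n := hN.trans (by exact_mod_cast hnN)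
      simp [kn, this]

/-- The Laplace integral is split at 1: local integrability controls it near 0, and the bound k ≤ k
1 controls it at infinity. -/
theorem IsPC.isDecreasingKernel {k : ℝ → ℝ} (hk : IsPC k) : IsDecreasingKernel k := by
  obtain ⟨l, h⟩ := hk
  refine ⟨h.nonneg_k, h.antitone_k, fun z hz => ?_⟩
  have hm := aestronglyMeasurable_of_antitoneOn h.antitone_k
  have h1 : IntegrableOn k (Icc 0 1) :=
    h.locallyIntegrable_k.integrableOn_compact_subset Icc_subset_Ici_self isCompact_Icc
  rw [← Ioc_union_Ioi_eq_Ioi (zero_le_one' ℝ)]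
  refine IntegrableOn.union ?_ ?_
  · refine Integrable.bdd_mul (c := 1) (h1.mono_set Ioc_subset_Icc_self) (by fun_prop) ?_
    filter_upwards [ae_restrict_mem measurableSet_Ioc] with t ht
    rw [Real.norm_of_nonneg (Real.exp_nonneg _)]
    exact Real.exp_le_one_iff.2 (by nlinarith [ht.1])
  · refine Integrable.mul_bdd (c := k 1) (integrableOn_exp_mul_Ioi (by linarith) 1)
      (hm.mono_measure (Measure.restrict_mono (Ioi_subset_Ioi zero_le_one) le_rfl)) ?_
    filter_upwards [ae_restrict_mem measurableSet_Ioi] with t (ht : 1 < t)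
    rw [Real.norm_of_nonneg (h.nonneg_k t (by linarith))]
    exact h.antitone_k (by simp) (show (0 : ℝ) < t by linarith) ht.le

/-! ### Identification of the propagation function. -/

theorem continuousWithinAt_measure_Iio (ν : Measure ℝ) (t : ℝ) :
    ContinuousWithinAt (fun s => ν (Iio s)) (Iio t) t := by
  have hmono : Monotone fun s => ν (Iio s) := fun a b hab => measure_mono (Iio_subset_Iio hab)
  refine tendsto_order.2 ⟨fun a ha => ?_, fun a ha => ?_⟩
  · change a < ν (Iio t) at ha
    have hm : Monotone fun n : ℕ => Iio (t - 1 / (n + 1 : ℝ)) := fun m n hmn =>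
      Iio_subset_Iio (sub_le_sub_left (Nat.one_div_le_one_div hmn) t)
    have hu : (⋃ n : ℕ, Iio (t - 1 / (n + 1 : ℝ))) = Iio t := by
      ext x
      simp only [mem_iUnion, mem_Iio]
      constructor
      · rintro ⟨n, hn⟩
        have : 0 < 1 / (n + 1 : ℝ) := Nat.one_div_pos_of_nat
        linarith
      · intro hx
        obtain ⟨n, hn⟩ := exists_nat_one_div_lt (sub_pos.2 hx)
        exact ⟨n, by linarith⟩
    rw [← hu, hm.measure_iUnion] at ha
    obtain ⟨n, hn⟩ := lt_iSup_iff.1 ha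
    have hlt : t - 1 / (n + 1 : ℝ) < t := sub_lt_self _ Nat.one_div_pos_of_nat
    filter_upwards [Ioo_mem_nhdsLT hlt] with s hs
    exact hn.trans_le (hmono hs.1.le)
  · filter_upwards [self_mem_nhdsWithin] with s (hs : s < t)
    exact (hmono hs.le).trans_lt ha

theorem boundedVariationOn_of_monotone {w : ℝ → ℝ} (hw : Monotone w) {C : ℝ} (h0 : ∀ t, 0 ≤ w t)
    (hC : ∀ t, w t ≤ C) (s : Set ℝ) : BoundedVariationOn w s := by
  refine ne_top_of_le_ne_top (ENNReal.ofReal_ne_top (r := C)) (iSup_le fun p => ?_)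
  obtain ⟨n, u, hu, hus⟩ := p
  simp only
  have : ∀ i, edist (w (u (i + 1))) (w (u i)) = ENNReal.ofReal (w (u (i + 1)) - w (u i)) := by
    intro i
    rw [edist_dist, Real.dist_eq, abs_of_nonneg (sub_nonneg.2 (hw (hu i.le_succ)))]
  simp_rw [this]
  rw [← ENNReal.ofReal_sum_of_nonneg (fun i _ => sub_nonneg.2 (hw (hu i.le_succ))),
    Finset.sum_range_sub (fun i => w (u i))]
  exact ENNReal.ofReal_le_ofReal (by linarith [h0 (u 0), hC (u n)])

theorem IsPropagationMeasure.integrableOn {k : ℝ → ℝ} {τ : ℝ} {ν : Measure ℝ}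
    (h : IsPropagationMeasure k τ ν) {z : ℝ} (hz : 0 < z) :
    IntegrableOn (fun σ => Real.exp (-z * σ) * ν.real (Iio σ)) (Ioi 0) := by
  have := h.isFiniteMeasure
  have hm : Monotone fun s => ν.real (Iio s) := fun a b hab => measureReal_mono (Iio_subset_Iio hab)
  refine integrableOn_exp_mul_of_bounded hm.measurable.aestronglyMeasurable (C := 1)
    (fun t _ => ?_) hz
  rw [abs_of_nonneg measureReal_nonneg]
  exact ENNReal.toReal_le_of_le_ofReal zero_le_one
    (by simpa using (measure_mono (subset_univ _)).trans h.univ_le)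

theorem IsPropagationMeasure.real_le_one {k : ℝ → ℝ} {τ : ℝ} {ν : Measure ℝ}
    (h : IsPropagationMeasure k τ ν) (s : Set ℝ) : ν.real s ≤ 1 :=
  ENNReal.toReal_le_of_le_ofReal zero_le_one
    (by simpa using (measure_mono (subset_univ s)).trans h.univ_le)

theorem IsPropagationMeasure.laplace_eq {k : ℝ → ℝ} {τ : ℝ} {ν : Measure ℝ}
    (h : IsPropagationMeasure k τ ν) {z : ℝ} (hz : 0 < z) :
    laplace (fun t => ν.real (Iio t)) z = Real.exp (-τ * (z * laplace k z)) / z := by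
  have := h.isFiniteMeasure
  have h1 := h.transform z hz
  rw [expTransform_eq_lintegral_Iio h.Iio_zero hz] at h1
  have h2 : ENNReal.ofReal (z * laplace (fun t => ν.real (Iio t)) z)
      = ∫⁻ σ in Ioi 0, ENNReal.ofReal (z * Real.exp (-z * σ)) * ν (Iio σ) := by
    unfold laplace
    rw [← integral_const_mul, ofReal_integral_eq_lintegral_ofReal
      ((h.integrableOn hz).const_mul z) (Eventually.of_forall fun σ => by positivity)]
    refine lintegral_congr fun σ => ?_
    rw [← mul_assoc, ENNReal.ofReal_mul (by positivity), ofReal_measureReal]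
  rw [h1] at h2
  have h3 : 0 ≤ laplace (fun t => ν.real (Iio t)) z := integral_nonneg fun σ => by positivity
  rw [ENNReal.ofReal_eq_ofReal_iff (by positivity) (Real.exp_nonneg _)] at h2
  rw [← h2]; field_simp

theorem IsPropagationMeasure.isPropagationFunction {k : ℝ → ℝ} {τ : ℝ} {ν : Measure ℝ}
    (h : IsPropagationMeasure k τ ν) :
    IsPropagationFunction k τ fun t => ν.real (Iio t) := by
  have := h.isFiniteMeasure
  have hm : Monotone fun s => ν.real (Iio s) := fun a b hab => measureReal_mono (Iio_subset_Iio hab)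
  refine ⟨hm.monotoneOn _, boundedVariationOn_of_monotone hm (fun _ => measureReal_nonneg)
    (fun t => h.real_le_one _) _, by simp [Measure.real, h.Iio_zero], fun t _ => ?_,
    fun z hz => h.laplace_eq hz⟩
  refine continuousWithinAt_Iio_iff_Iic.1 ?_
  exact (ENNReal.tendsto_toReal (measure_ne_top ν _)).comp (continuousWithinAt_measure_Iio ν t)

/-- The propagation function is the distribution function of the propagation measure. -/
theorem IsPropagationFunction.eq_real_Iio {k : ℝ → ℝ} {τ : ℝ} {w : ℝ → ℝ} {ν : Measure ℝ}
    (hw : IsPropagationFunction k τ w) (hν : IsPropagationMeasure k τ ν) {t : ℝ} (ht : 0 ≤ t) :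
    w t = ν.real (Iio t) := by
  -- Continued by w 0 = 0 to negative arguments, w defines a Stieltjes measure on the half-line. Its
  -- transform is z ŵ(z), which agrees with that of ν.
  let F : ℝ → ℝ := fun s => w (max s 0)
  have hF : Monotone F := fun a b hab =>
    hw.monotone (le_max_right a 0) (le_max_right b 0) (max_le_max hab le_rfl)
  have hFA : ∀ x < 0, F x = 0 := fun x hx => by simp [F, hx.le, hw.map_zero]
  have hF0 : ∀ x, 0 ≤ F x := fun x => by
    simpa [hw.map_zero] using hw.monotone (self_mem_Ici (a := (0 : ℝ))) (le_max_right x 0)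
      (le_max_right x 0)
  obtain ⟨C, hC⟩ : ∃ C, ∀ s, 0 ≤ s → |w s| ≤ C := by
    refine ⟨(eVariationOn w (Ici 0)).toReal, fun s hs => ?_⟩
    have := hw.boundedVariation.dist_le hs (self_mem_Ici (a := (0 : ℝ)))
    simpa [Real.dist_eq, hw.map_zero] using this
  have hT : ∀ z, 0 < z → expTransform hF.stieltjesFunction.measure z = expTransform ν z := by
    intro z hz
    rw [hν.transform z hz, expTransform_stieltjes hF hFA hz,
      show Real.exp (-τ * (z * laplace k z)) = z * laplace w z by
        rw [hw.laplace_eq z hz]; field_simp]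
    have hi : IntegrableOn (fun σ => Real.exp (-z * σ) * w σ) (Ioi 0) :=
      integrableOn_exp_mul_of_bounded (aemeasurable_restrict_of_monotoneOn measurableSet_Ioi
        (hw.monotone.mono Ioi_subset_Ici_self)).aestronglyMeasurable
        (fun t ht => hC t (le_of_lt ht)) hz
    unfold laplace
    have hw0 : ∀ σ ∈ Ioi (0 : ℝ), F σ = w σ := fun σ (hσ : 0 < σ) => by simp [F, hσ.le]
    rw [← integral_const_mul, ofReal_integral_eq_lintegral_ofReal (hi.const_mul z)]
    · refine setLIntegral_congr_fun measurableSet_Ioi fun σ hσ => ?_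
      simp only [sub_zero]
      rw [← ENNReal.ofReal_mul (by positivity), hw0 σ hσ, mul_assoc]
    · filter_upwards [ae_restrict_mem measurableSet_Ioi] with σ hσ
      have := hF0 σ
      rw [hw0 σ hσ] at this
      simp only [Pi.zero_apply]
      positivity
  have heq : hF.stieltjesFunction.measure = ν :=
    eq_of_expTransform_eq (stieltjes_Iio_zero hF hFA) hν.Iio_zero
      (fun z hz => by rw [hT z hz, hν.transform z hz]; exact ENNReal.ofReal_ne_top) hT
  rcases ht.eq_or_lt with rfl | ht
  · simp [hw.map_zero, Measure.real, hν.Iio_zero]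
  have hc : ContinuousWithinAt F (Iio t) t := by
    have h1 := (hw.leftContinuous t ht).mono Iio_subset_Iic_self
    refine h1.congr_of_eventuallyEq ?_ (by simp [F, ht.le])
    filter_upwards [Ioo_mem_nhdsLT ht] with s hs
    simp [F, hs.1.le]
  have := stieltjes_Iio hF hFA hc
  rw [heq] at this
  rw [Measure.real, this, sub_zero, ENNReal.toReal_ofReal (hF0 t)]
  simp [F, ht.le]

theorem IsPropagationMeasure.propagation_eq {k : ℝ → ℝ} {τ : ℝ} {ν : Measure ℝ}
    (hν : IsPropagationMeasure k τ ν) {t : ℝ} (ht : 0 ≤ t) :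
    propagation k t τ = ν.real (Iio t) := by
  have h : ∃ w : ℝ → ℝ, IsPropagationFunction k τ w := ⟨_, hν.isPropagationFunction⟩
  rw [propagation, dif_pos h]
  exact h.choose_spec.eq_real_Iio hν ht

/-- Distribution functions of propagation measures decrease along the parameter. -/
theorem IsPropagationMeasure.Iio_anti {k : ℝ → ℝ} (hk : IsDecreasingKernel k) {τ₁ τ₂ : ℝ}
    (h12 : τ₁ ≤ τ₂) {ν₁ ν₂ : Measure ℝ} (h₁ : IsPropagationMeasure k τ₁ ν₁)
    (h₂ : IsPropagationMeasure k τ₂ ν₂) (t : ℝ) : ν₂ (Iio t) ≤ ν₁ (Iio t) := by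
  obtain ⟨ρ, hρ⟩ := exists_isPropagationMeasure hk (sub_nonneg.2 h12)
  have := h₁.isFiniteMeasure
  have := hρ.isFiniteMeasure
  have h3 : IsPropagationMeasure k τ₂ (ν₁ ∗ ρ) := h₁.conv hρ fun z _ => by ring
  -- Semigroup law in τ: by uniqueness, ν₂ arises from ν₁ by convolution with a sub-probability
  -- measure.
  have : ν₂ = ν₁ ∗ ρ := eq_of_expTransform_eq h₂.Iio_zero h3.Iio_zero
    (fun z hz => by rw [h₂.transform z hz]; exact ENNReal.ofReal_ne_top)
    (fun z hz => by rw [h₂.transform z hz, h3.transform z hz])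
  rw [this]
  exact (conv_Iio_le hρ.Iio_zero t).trans (mul_le_of_le_one_right' hρ.univ_le)

/-! ### Joint measurability, and convolution with a decreasing kernel. -/

/-- A function which is left-continuous in the first and measurable in the second variable is
jointly measurable. -/
theorem measurable_uncurry_of_leftContinuous {W : ℝ → ℝ → ℝ≥0∞}
    (hl : ∀ τ t, ContinuousWithinAt (fun s => W s τ) (Iio t) t) (hm : ∀ t, Measurable (W t)) :
    Measurable (Function.uncurry W) := by
  -- The last grid point of mesh 1/(n+1) strictly below t; subtracting 1 from the ceiling keeps it
  -- strictly to the left even if t lies on the grid. Only countably many first arguments occur for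
  -- each n.
  let a : ℕ → ℝ → ℝ := fun n t => ((⌈t * (n + 1)⌉ : ℝ) - 1) / (n + 1)
  have hlt : ∀ n t, a n t < t := by
    intro n t
    have hp : (0 : ℝ) < n + 1 := by positivity
    rw [div_lt_iff₀ hp]
    linarith [Int.ceil_lt_add_one (t * (n + 1))]
  have hge : ∀ (n : ℕ) t, t - 1 / (n + 1 : ℝ) ≤ a n t := by
    intro n t
    have hp : (0 : ℝ) < n + 1 := by positivity
    rw [le_div_iff₀ hp, sub_mul, one_div_mul_cancel hp.ne']
    linarith [Int.le_ceil (t * (n + 1))]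
  have hlim : ∀ t, Tendsto (fun n => a n t) atTop (𝓝[<] t) := by
    intro t
    refine tendsto_nhdsWithin_iff.2 ⟨?_, Eventually.of_forall fun n => hlt n t⟩
    refine tendsto_of_tendsto_of_tendsto_of_le_of_le ?_ tendsto_const_nhds (fun n => hge n t)
      (fun n => (hlt n t).le)
    simpa using tendsto_const_nhds.sub (tendsto_one_div_add_atTop_nhds_zero_nat (𝕜 := ℝ))
  refine measurable_of_tendsto_metrizable (f := fun n (p : ℝ × ℝ) => W (a n p.1) p.2)
    (fun n => ?_) (tendsto_pi_nhds.2 fun p => ?_)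
  · have h1 : Measurable fun q : ℤ × ℝ => W (((q.1 : ℝ) - 1) / (n + 1)) q.2 :=
      measurable_from_prod_countable_right fun z => hm (((z : ℝ) - 1) / (n + 1))
    have h2 : Measurable fun p : ℝ × ℝ => (⌈p.1 * (n + 1)⌉, p.2) :=
      (Int.measurable_ceil.comp (by fun_prop)).prodMk measurable_snd
    exact h1.comp h2
  · exact (hl p.2 p.1).tendsto.comp (hlim p.1)

/-- A kernel, continued by `∞` to the negative half-line. -/
def extendedKernel (k : ℝ → ℝ) (t : ℝ) : ℝ≥0∞ := if t ≤ 0 then ∞ else ENNReal.ofReal (k t)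

theorem extendedKernel_of_pos {k : ℝ → ℝ} {t : ℝ} (ht : 0 < t) :
    extendedKernel k t = ENNReal.ofReal (k t) := by
  simp [extendedKernel, not_le.2 ht]

theorem antitone_extendedKernel {k : ℝ → ℝ} (hk : AntitoneOn k (Ioi 0)) :
    Antitone (extendedKernel k) := by
  intro s t hst
  rcases le_or_gt s 0 with hs | hs
  · simp [extendedKernel, hs]
  · rw [extendedKernel_of_pos hs, extendedKernel_of_pos (hs.trans_le hst)]
    exact ENNReal.ofReal_le_ofReal (hk hs (hs.trans_le hst) hst)

theorem expTransform_withDensity {f : ℝ → ℝ≥0∞} (hf : Measurable f) (z : ℝ) :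
    expTransform ((volume.restrict (Ioi 0)).withDensity f) z
      = ∫⁻ t in Ioi 0, ENNReal.ofReal (Real.exp (-z * t)) * f t := by
  rw [expTransform, lintegral_withDensity_eq_lintegral_mul _ hf (measurable_ofReal_exp z)]
  exact lintegral_congr fun t => mul_comm _ _

theorem withDensity_Iio_zero (f : ℝ → ℝ≥0∞) :
    ((volume.restrict (Ioi (0 : ℝ))).withDensity f) (Iio 0) = 0 := by
  refine withDensity_absolutelyContinuous _ _ ?_
  rw [Measure.restrict_apply measurableSet_Iio]
  convert measure_empty (μ := (volume : Measure ℝ))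
  ext x; simp only [mem_inter_iff, mem_Iio, mem_Ioi, mem_empty_iff_false, iff_false]
  intro h; linarith [h.1, h.2]

theorem laplace_nonneg {k : ℝ → ℝ} (hk : IsDecreasingKernel k) (z : ℝ) : 0 ≤ laplace k z :=
  setIntegral_nonneg measurableSet_Ioi fun σ hσ => mul_nonneg (Real.exp_nonneg _) (hk.nonneg σ hσ)

theorem expTransform_kernel {k : ℝ → ℝ} (hk : IsDecreasingKernel k) {z : ℝ} (hz : 0 < z) :
    expTransform ((volume.restrict (Ioi 0)).withDensity (extendedKernel k)) z
      = ENNReal.ofReal (laplace k z) := by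
  rw [expTransform_withDensity (antitone_extendedKernel hk.antitone).measurable, laplace,
    ofReal_integral_eq_lintegral_ofReal (hk.integrable z hz)]
  · refine setLIntegral_congr_fun measurableSet_Ioi fun σ hσ => ?_
    simp only [extendedKernel_of_pos hσ]
    rw [ENNReal.ofReal_mul (Real.exp_nonneg _)]
  · filter_upwards [ae_restrict_mem measurableSet_Ioi] with σ hσ
    exact mul_nonneg (Real.exp_nonneg _) (hk.nonneg σ hσ)

/-- The convolution of a decreasing kernel with a measure `γ` on `[0, ∞)` has a density that is
bounded from below by `k(t) γ([0, t))`. -/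
theorem withDensity_mul_le_conv {κ : ℝ → ℝ≥0∞} (hκ : Antitone κ) {γ : Measure ℝ} [SFinite γ]
    (hγ : γ (Iio 0) = 0) :
    (volume.restrict (Ioi 0)).withDensity (fun t => κ t * γ (Iio t))
      ≤ γ ∗ (volume.restrict (Ioi 0)).withDensity κ := by
  refine Measure.le_intro fun A hA _ => ?_
  have hmκ : Measurable κ := hκ.measurable
  have hmA : Measurable (A.indicator fun _ : ℝ => (1 : ℝ≥0∞)) := measurable_const.indicator hA
  have hR : (γ ∗ (volume.restrict (Ioi 0)).withDensity κ) A
      = ∫⁻ x, (∫⁻ t, (Ioi (0 : ℝ)).indicator κ (t - x) * A.indicator (fun _ => 1) t) ∂γ := by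
    rw [← lintegral_indicator_one hA]
    erw [Measure.lintegral_conv hmA]
    refine lintegral_congr fun x => ?_
    have h1 := lintegral_withDensity_eq_lintegral_mul (volume.restrict (Ioi 0)) hmκ
      (hmA.comp (measurable_const_add x))
    simp only [Function.comp_def] at h1
    rw [h1, ← lintegral_indicator measurableSet_Ioi, ← lintegral_sub_right_eq_self _ x]
    refine lintegral_congr fun t => ?_
    by_cases h : t - x ∈ Ioi (0 : ℝ)
    · simp only [indicator_of_mem h, Pi.mul_apply, add_sub_cancel]
    · simp [indicator_of_notMem h]
  have hm : Measurable ({p : ℝ × ℝ | p.1 < p.2}.indicator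
      fun p => κ p.2 * A.indicator (fun _ => 1) p.2) :=
    ((hmκ.comp measurable_snd).mul (hmA.comp measurable_snd)).indicator
      (measurableSet_lt measurable_fst measurable_snd)
  calc (volume.restrict (Ioi 0)).withDensity (fun t => κ t * γ (Iio t)) A
      ≤ ∫⁻ t, κ t * A.indicator (fun _ => 1) t * γ (Iio t) := by
        rw [withDensity_apply _ hA, Measure.restrict_restrict hA]
        refine (lintegral_mono_set inter_subset_left).trans ?_
        rw [← lintegral_indicator hA]
        refine lintegral_mono fun t => ?_
        by_cases h : t ∈ A <;> simp [h]
    _ = ∫⁻ t, (∫⁻ x, {p : ℝ × ℝ | p.1 < p.2}.indicator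
          (fun p => κ p.2 * A.indicator (fun _ => 1) p.2) (x, t) ∂γ) := by
        refine lintegral_congr fun t => ?_
        have : ∀ x, {p : ℝ × ℝ | p.1 < p.2}.indicator
            (fun p => κ p.2 * A.indicator (fun _ => 1) p.2) (x, t)
            = (Iio t).indicator (fun _ => κ t * A.indicator (fun _ => 1) t) x := by
          intro x
          by_cases h : x < t <;> simp [indicator, h]
        simp_rw [this]
        rw [lintegral_indicator measurableSet_Iio, lintegral_const, Measure.restrict_apply_univ]
    _ = ∫⁻ x, (∫⁻ t, {p : ℝ × ℝ | p.1 < p.2}.indicator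
          (fun p => κ p.2 * A.indicator (fun _ => 1) p.2) (x, t)) ∂γ :=
        (lintegral_lintegral_swap (f := fun x t => {p : ℝ × ℝ | p.1 < p.2}.indicator
          (fun p => κ p.2 * A.indicator (fun _ => 1) p.2) (x, t)) hm.aemeasurable).symm
    _ ≤ _ := by
        rw [hR]
        refine lintegral_mono_ae ?_
        filter_upwards [ae_nonneg_of_Iio hγ] with x hx
        refine lintegral_mono fun t => ?_
        by_cases h : x < t
        · rw [indicator_of_mem (show (x, t) ∈ {p : ℝ × ℝ | p.1 < p.2} from h),
            indicator_of_mem (show t - x ∈ Ioi (0 : ℝ) from sub_pos.2 h)]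
          -- Here monotonicity of the kernel enters: t - x ≤ t gives κ t ≤ κ (t - x).
          exact mul_le_mul_left (hκ (by linarith)) _
        · rw [indicator_of_notMem (show (x, t) ∉ {p : ℝ × ℝ | p.1 < p.2} from h)]
          exact zero_le

/-! ### The relaxation function and its lower bound. -/

section Relaxation

variable {k : ℝ → ℝ} (hk : IsDecreasingKernel k)

/-- The convolution semigroup of propagation measures, constant for negative parameters. -/
def propMeas (τ : ℝ) : Measure ℝ := (exists_isPropagationMeasure hk (le_max_right τ 0)).choose

theorem propMeas_spec (τ : ℝ) : IsPropagationMeasure k (max τ 0) (propMeas hk τ) :=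
  (exists_isPropagationMeasure hk (le_max_right τ 0)).choose_spec

/-- The joint distribution function of the propagation measures. -/
def propDist (t τ : ℝ) : ℝ≥0∞ := propMeas hk τ (Iio t)

theorem propDist_le_one (t τ : ℝ) : propDist hk t τ ≤ 1 :=
  (measure_mono (subset_univ _)).trans (propMeas_spec hk τ).univ_le

theorem propDist_ne_top (t τ : ℝ) : propDist hk t τ ≠ ∞ :=
  ((propDist_le_one hk t τ).trans_lt ENNReal.one_lt_top).ne

theorem propDist_mono {s t : ℝ} (h : s ≤ t) (τ : ℝ) : propDist hk s τ ≤ propDist hk t τ :=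
  measure_mono (Iio_subset_Iio h)

theorem propDist_anti (t : ℝ) : Antitone (propDist hk t) := fun _ _ h =>
  IsPropagationMeasure.Iio_anti hk (max_le_max h le_rfl) (propMeas_spec hk _) (propMeas_spec hk _) t

theorem propDist_of_nonpos {t : ℝ} (ht : t ≤ 0) (τ : ℝ) : propDist hk t τ = 0 :=
  measure_mono_null (Iio_subset_Iio ht) (propMeas_spec hk τ).Iio_zero

theorem measurable_propDist : Measurable (Function.uncurry (propDist hk)) :=
  measurable_uncurry_of_leftContinuous (fun _ t => continuousWithinAt_measure_Iio _ t)
    fun t => (propDist_anti hk t).measurable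

theorem propagation_max_eq {t : ℝ} (ht : 0 ≤ t) (τ : ℝ) :
    propagation k t (max τ 0) = (propDist hk t τ).toReal :=
  (propMeas_spec hk τ).propagation_eq ht

theorem lintegral_propDist {z : ℝ} (hz : 0 < z) {τ : ℝ} (hτ : 0 ≤ τ) :
    ∫⁻ t in Ioi 0, ENNReal.ofReal (z * Real.exp (-z * t)) * propDist hk t τ
      = ENNReal.ofReal (Real.exp (-τ * (z * laplace k z))) := by
  have h := propMeas_spec hk τ
  have := h.isFiniteMeasure
  rw [max_eq_left hτ] at h
  rw [← h.transform z hz, expTransform_eq_lintegral_Iio h.Iio_zero hz]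
  rfl

theorem lintegral_Ioi_zero_exp {z : ℝ} (hz : 0 < z) :
    ∫⁻ t in Ioi 0, ENNReal.ofReal (z * Real.exp (-z * t)) = 1 := by
  rw [lintegral_Ioi_exp hz]; simp

/-- For almost every `t`, the distribution function `w(t, τ)` tends to `1` as `τ → 0`. -/
theorem ae_iSup_propDist_eq_one :
    ∀ᵐ t : ℝ, 0 < t → ⨆ n : ℕ, propDist hk t (1 / (n + 1)) = 1 := by
  refine (ae_restrict_iff' (s := Ioi (0 : ℝ)) measurableSet_Ioi).1 ?_
  let e : ℝ → ℝ≥0∞ := fun t => ENNReal.ofReal (1 * Real.exp (-1 * t))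
  have he : Measurable e := by fun_prop
  have hm : ∀ n : ℕ, Measurable fun t => propDist hk t (1 / (n + 1)) := fun n =>
    Monotone.measurable fun s t h => propDist_mono hk h _
  -- The weighted integral of the supremum equals that of the constant 1, since exp(-τ k̂(1)) → 1 as
  -- τ → 0. As the supremum is at most 1, the two agree almost everywhere.
  have h1 : ∫⁻ t in Ioi 0, e t * ⨆ n : ℕ, propDist hk t (1 / (n + 1)) = 1 := by
    simp_rw [ENNReal.mul_iSup]
    rw [lintegral_iSup (f := fun (n : ℕ) t => e t * propDist hk t (1 / (n + 1)))
      (fun n => he.mul (hm n)) (fun m n hmn t => mul_le_mul_right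
      (propDist_anti hk t (Nat.one_div_le_one_div hmn)) _)]
    simp_rw [e, lintegral_propDist hk one_pos (Nat.one_div_pos_of_nat.le)]
    refine le_antisymm (iSup_le fun n => ?_) ?_
    · rw [ENNReal.ofReal_le_one]
      have := laplace_nonneg hk 1
      refine Real.exp_le_one_iff.2 ?_
      have : 0 ≤ 1 / ((n : ℝ) + 1) * (1 * laplace k 1) := by positivity
      linarith
    · have ht : Tendsto (fun n : ℕ => ENNReal.ofReal
          (Real.exp (-(1 / ((n : ℝ) + 1)) * (1 * laplace k 1)))) atTop (𝓝 1) := by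
        rw [← ENNReal.ofReal_one, ← Real.exp_zero]
        refine ENNReal.tendsto_ofReal ((Real.continuous_exp.tendsto _).comp ?_)
        simpa using ((tendsto_one_div_add_atTop_nhds_zero_nat (𝕜 := ℝ)).neg.mul_const
          (1 * laplace k 1))
      exact le_of_tendsto' ht fun n => le_iSup (fun n : ℕ => ENNReal.ofReal
          (Real.exp (-(1 / ((n : ℝ) + 1)) * (1 * laplace k 1)))) n
  have h2 : (fun t => e t * ⨆ n : ℕ, propDist hk t (1 / (n + 1)))
      =ᵐ[volume.restrict (Ioi 0)] e := by
    refine ae_eq_of_ae_le_of_lintegral_le ?_ ?_ he.aemeasurable ?_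
    · exact Eventually.of_forall fun t => mul_le_of_le_one_right'
        (iSup_le fun n => propDist_le_one hk t _)
    · rw [h1]; exact ENNReal.one_ne_top
    · rw [h1]; exact (lintegral_Ioi_zero_exp one_pos).le
  filter_upwards [h2] with t ht
  have h0 : e t ≠ 0 := by simp [e, Real.exp_pos]
  have h3 : e t ≠ ∞ := by simp [e]
  rw [show e t = e t * 1 by simp, mul_assoc, one_mul] at ht
  exact (ENNReal.mul_right_inj h0 h3).1 ht

/-- The relaxation function `∫ exp (-μ τ) d(-w(t, τ))`, after integration by parts. -/
def relaxation (μ t : ℝ) : ℝ≥0∞ :=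
  ∫⁻ τ in Ioi 0, ENNReal.ofReal (μ * Real.exp (-μ * τ)) * (1 - propDist hk t τ)

/-- The complement `1 - s` of the relaxation function. -/
def coRelaxation (μ t : ℝ) : ℝ≥0∞ :=
  ∫⁻ τ in Ioi 0, ENNReal.ofReal (μ * Real.exp (-μ * τ)) * propDist hk t τ

theorem relaxation_add_coRelaxation {μ : ℝ} (hμ : 0 < μ) (t : ℝ) :
    relaxation hk μ t + coRelaxation hk μ t = 1 := by
  have hm := (propDist_anti hk t).measurable
  rw [relaxation, coRelaxation, ← lintegral_add_right _ (by fun_prop)]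
  refine Eq.trans ?_ (lintegral_Ioi_zero_exp hμ)
  refine lintegral_congr fun τ => ?_
  rw [← mul_add, tsub_add_cancel_of_le (propDist_le_one hk t τ), mul_one]

theorem coRelaxation_le_one {μ : ℝ} (hμ : 0 < μ) (t : ℝ) : coRelaxation hk μ t ≤ 1 := by
  rw [← relaxation_add_coRelaxation hk hμ t]; exact le_add_self

theorem measurable_relaxation (μ : ℝ) : Measurable (relaxation hk μ) := by
  refine Measurable.lintegral_prod_right' (f := fun p : ℝ × ℝ =>
    ENNReal.ofReal (μ * Real.exp (-μ * p.2)) * (1 - propDist hk p.1 p.2)) ?_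
  exact Measurable.mul (by fun_prop) ((measurable_propDist hk).const_sub 1)

theorem monotone_coRelaxation (μ : ℝ) : Monotone (coRelaxation hk μ) := fun _ _ h =>
  lintegral_mono fun τ => mul_le_mul_right (propDist_mono hk h τ) _

/-- By Tonelli, integration in t comes first and gives exp(-τ z k̂(z)); the remaining integral of μ
exp(-τ(μ + z k̂(z))) is elementary. -/
theorem lintegral_coRelaxation {μ z : ℝ} (hμ : 0 < μ) (hz : 0 < z) :
    ∫⁻ t in Ioi 0, ENNReal.ofReal (z * Real.exp (-z * t)) * coRelaxation hk μ t
      = ENNReal.ofReal (μ / (μ + z * laplace k z)) := by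
  have hφ : 0 ≤ z * laplace k z := mul_nonneg hz.le (laplace_nonneg hk z)
  have hm := measurable_propDist hk
  have hm' : Measurable fun p : ℝ × ℝ => propDist hk p.1 p.2 := hm
  have h1 : ∀ t, ENNReal.ofReal (z * Real.exp (-z * t)) * coRelaxation hk μ t
      = ∫⁻ τ in Ioi 0, ENNReal.ofReal (μ * Real.exp (-μ * τ)) *
        (ENNReal.ofReal (z * Real.exp (-z * t)) * propDist hk t τ) := by
    intro t
    have := (propDist_anti hk t).measurable
    rw [coRelaxation, ← lintegral_const_mul _ (by fun_prop)]
    exact lintegral_congr fun τ => mul_left_comm _ _ _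
  simp_rw [h1]
  rw [lintegral_lintegral_swap (by
    refine Measurable.aemeasurable ?_
    unfold Function.uncurry
    exact Measurable.mul (by fun_prop) (Measurable.mul (by fun_prop) hm'))]
  have h2 : ∀ τ ∈ Ioi (0 : ℝ), ∫⁻ t in Ioi 0, ENNReal.ofReal (μ * Real.exp (-μ * τ)) *
        (ENNReal.ofReal (z * Real.exp (-z * t)) * propDist hk t τ)
      = ENNReal.ofReal (μ / (μ + z * laplace k z)) * ENNReal.ofReal ((μ + z * laplace k z) *
        Real.exp (-(μ + z * laplace k z) * τ)) := by
    intro τ hτ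
    have : Measurable fun t => propDist hk t τ := Monotone.measurable fun s t h => propDist_mono hk h _
    rw [lintegral_const_mul _ (by fun_prop), lintegral_propDist hk hz (le_of_lt hτ),
      ← ENNReal.ofReal_mul (by positivity), ← ENNReal.ofReal_mul (by positivity), mul_assoc,
      ← Real.exp_add]
    congr 1
    rw [← mul_assoc (μ / _), div_mul_cancel₀ _ (by positivity)]
    congr 2; ring
  rw [setLIntegral_congr_fun measurableSet_Ioi h2, lintegral_const_mul _ (by fun_prop),
    lintegral_Ioi_zero_exp (by positivity), mul_one]

theorem lintegral_relaxation {μ z : ℝ} (hμ : 0 < μ) (hz : 0 < z) :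
    ∫⁻ t in Ioi 0, ENNReal.ofReal (z * Real.exp (-z * t)) * relaxation hk μ t
      = ENNReal.ofReal (z * laplace k z / (μ + z * laplace k z)) := by
  have hφ : 0 ≤ z * laplace k z := mul_nonneg hz.le (laplace_nonneg hk z)
  have hm := measurable_relaxation hk μ
  have h : (∫⁻ t in Ioi 0, ENNReal.ofReal (z * Real.exp (-z * t)) * relaxation hk μ t)
      + ∫⁻ t in Ioi 0, ENNReal.ofReal (z * Real.exp (-z * t)) * coRelaxation hk μ t = 1 := by
    rw [← lintegral_add_left (by fun_prop)]
    refine Eq.trans ?_ (lintegral_Ioi_zero_exp hz)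
    refine lintegral_congr fun t => ?_
    rw [← mul_add, relaxation_add_coRelaxation hk hμ, mul_one]
  rw [lintegral_coRelaxation hk hμ hz] at h
  rw [ENNReal.eq_sub_of_add_eq ENNReal.ofReal_ne_top h, ← ENNReal.ofReal_one,
    ← ENNReal.ofReal_sub _ (by positivity)]
  congr 1
  field_simp
  ring

/-- The relaxation function satisfies `k (1 - s) ≤ μ s` almost everywhere. -/
theorem ae_kernel_mul_coRelaxation_le {μ : ℝ} (hμ : 0 < μ) :
    ∀ᵐ t : ℝ, 0 < t →
      ENNReal.ofReal (k t) * coRelaxation hk μ t ≤ ENNReal.ofReal μ * relaxation hk μ t := by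
  -- G = 1 - s is nondecreasing and vanishes for t < 0, so γ = dG is a finite measure on the
  -- half-line. The measures γ * k and μ s dt both have transform μ k̂ / (μ + z k̂), hence coincide,
  -- and γ * k has density at least k(t) γ([0, t)).
  let G : ℝ → ℝ := fun t => (coRelaxation hk μ t).toReal
  have hGt : ∀ t, coRelaxation hk μ t ≠ ∞ := fun t =>
    ((coRelaxation_le_one hk hμ t).trans_lt ENNReal.one_lt_top).ne
  have hG : Monotone G := fun s t h => ENNReal.toReal_mono (hGt t) (monotone_coRelaxation hk μ h)
  have hGA : ∀ x < 0, G x = 0 := fun x hx => by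
    simp [G, coRelaxation, propDist_of_nonpos hk hx.le]
  have hGC : ∀ x, G x ≤ 1 := fun x =>
    ENNReal.toReal_le_of_le_ofReal zero_le_one (by simpa using coRelaxation_le_one hk hμ x)
  set γ := hG.stieltjesFunction.measure with hγ
  have hγ0 : γ (Iio 0) = 0 := stieltjes_Iio_zero hG hGA
  have hγf : IsFiniteMeasure γ :=
    ⟨(stieltjes_univ_le hG hGA hGC).trans_lt ENNReal.ofReal_lt_top⟩
  have hκ := antitone_extendedKernel hk.antitone
  have hD : Measurable fun t => ENNReal.ofReal μ * relaxation hk μ t :=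
    (measurable_relaxation hk μ).const_mul _
  have hT : ∀ z, 0 < z →
      expTransform (γ ∗ (volume.restrict (Ioi 0)).withDensity (extendedKernel k)) z
        = ENNReal.ofReal (μ / (μ + z * laplace k z) * laplace k z) := by
    intro z hz
    have hk0 := laplace_nonneg hk z
    rw [expTransform_conv, expTransform_kernel hk hz, hγ, expTransform_stieltjes hG hGA hz,
      ENNReal.ofReal_mul (by positivity), ← lintegral_coRelaxation hk hμ hz]
    congr 1
    refine lintegral_congr fun t => ?_
    simp only [G, sub_zero]
    rw [ENNReal.ofReal_toReal (hGt t)]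
  have hTD : ∀ z, 0 < z → expTransform
      ((volume.restrict (Ioi 0)).withDensity fun t => ENNReal.ofReal μ * relaxation hk μ t) z
        = ENNReal.ofReal (μ / (μ + z * laplace k z) * laplace k z) := by
    intro z hz
    have hk0 := laplace_nonneg hk z
    have hm := measurable_relaxation hk μ
    rw [expTransform_withDensity hD]
    have : ∀ t, ENNReal.ofReal (Real.exp (-z * t)) * (ENNReal.ofReal μ * relaxation hk μ t)
        = ENNReal.ofReal (μ / z) *
          (ENNReal.ofReal (z * Real.exp (-z * t)) * relaxation hk μ t) := by
      intro t
      rw [← mul_assoc, ← mul_assoc, ← ENNReal.ofReal_mul (by positivity),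
        ← ENNReal.ofReal_mul (by positivity)]
      congr 2; field_simp
    simp_rw [this]
    rw [lintegral_const_mul _ (by fun_prop), lintegral_relaxation hk hμ hz,
      ← ENNReal.ofReal_mul (by positivity)]
    congr 1; field_simp
  have heq := eq_of_expTransform_eq (conv_Iio_zero hγ0 (withDensity_Iio_zero _))
    (withDensity_Iio_zero fun t => ENNReal.ofReal μ * relaxation hk μ t)
    (fun z hz => by rw [hT z hz]; exact ENNReal.ofReal_ne_top)
    (fun z hz => by rw [hT z hz, hTD z hz])
  have hle := withDensity_mul_le_conv hκ hγ0
  rw [heq] at hle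
  have hmγ : Measurable fun t => γ (Iio t) :=
    Monotone.measurable fun s t h => measure_mono (Iio_subset_Iio h)
  have hae : (fun t => extendedKernel k t * γ (Iio t)) ≤ᵐ[volume.restrict (Ioi 0)]
      fun t => ENNReal.ofReal μ * relaxation hk μ t := by
    refine ae_le_of_forall_setLIntegral_le_of_sigmaFinite (hκ.measurable.mul hmγ)
      fun s hs _ => ?_
    rw [← withDensity_apply _ hs, ← withDensity_apply _ hs]
    exact hle s
  filter_upwards [(ae_restrict_iff' measurableSet_Ioi).1 hae, ae_continuousAt_of_monotone hG]
    with t ht hc ht0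
  have := ht ht0
  rwa [extendedKernel_of_pos ht0, hγ, stieltjes_Iio hG hGA hc.continuousWithinAt, sub_zero,
    ENNReal.ofReal_toReal (hGt t)] at this

/-- This selects the Stieltjes branch in the definition of `propagationMeasure`. -/
theorem monotone_neg_propagation {k : ℝ → ℝ} (hk : IsDecreasingKernel k) {t : ℝ} (ht : 0 ≤ t) :
    Monotone fun τ : ℝ => -propagation k t (max τ 0) := by
  intro a b hab
  simp only [propagation_max_eq hk ht]
  exact neg_le_neg (ENNReal.toReal_mono (propDist_ne_top hk t a) (propDist_anti hk t hab))

theorem propagationMeasure_eq {t : ℝ} (ht : 0 ≤ t) :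
    propagationMeasure k t = (monotone_neg_propagation hk ht).stieltjesFunction.measure :=
  dif_pos (monotone_neg_propagation hk ht)

theorem propagationMeasure_univ_le {k : ℝ → ℝ} (hk : IsDecreasingKernel k) {t : ℝ} (ht : 0 ≤ t) : propagationMeasure k t univ ≤ 1 := by
  rw [propagationMeasure_eq hk ht]
  refine (stieltjes_univ_le (A := -propagation k t 0) (C := 0) (monotone_neg_propagation hk ht)
    (fun x hx => by rw [max_eq_right hx.le]) (fun x => ?_)).trans ?_
  · rw [propagation_max_eq hk ht]
    exact neg_nonpos.2 ENNReal.toReal_nonneg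
  · have := propagation_max_eq hk ht 0
    rw [max_self] at this
    rw [this, zero_sub, neg_neg, ENNReal.ofReal_toReal (propDist_ne_top hk t 0)]
    exact propDist_le_one hk t 0

/-- For almost every `t`, the measure `-d_τ w(t, τ)` has no atom at `0` and its Laplace transform
is the relaxation function. -/
theorem ae_lintegral_propagationMeasure :
    ∀ᵐ t : ℝ, 0 < t → ∀ μ, 0 < μ →
      ∫⁻ τ in Ioi 0, ENNReal.ofReal (Real.exp (-μ * τ)) ∂(propagationMeasure k t)
        = relaxation hk μ t := by
  filter_upwards [ae_iSup_propDist_eq_one hk] with t hsup ht μ hμ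
  have hs := hsup ht
  have hF := monotone_neg_propagation hk ht.le
  have hW0 : propagation k t 0 = 1 := by
    have h1 := propagation_max_eq hk ht.le 0
    have h2 : propDist hk t 0 = 1 := by
      refine le_antisymm (propDist_le_one hk t 0) ?_
      rw [← hs]
      exact iSup_le fun n => propDist_anti hk t Nat.one_div_pos_of_nat.le
    rwa [max_self, h2, ENNReal.toReal_one] at h1
  have hFA : ∀ x < 0, -propagation k t (max x 0) = -1 := fun x hx => by
    rw [max_eq_right hx.le, hW0]
  -- Since w(t, 0+) = 1 = w(t, 0), there is no mass at τ = 0, and integrating over τ > 0 loses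
  -- nothing.
  have hatom : hF.stieltjesFunction.measure (Iic 0) = 0 := by
    rw [StieltjesFunction.measure_Iic _ (tendsto_stieltjesFunction_atBot hF hFA),
      ENNReal.ofReal_eq_zero, hF.stieltjesFunction_eq, sub_nonpos]
    have hlim : Tendsto (fun n : ℕ => -(propDist hk t (1 / (n + 1))).toReal) atTop (𝓝 (-1)) := by
      rw [show (-1 : ℝ) = -(⨆ n : ℕ, propDist hk t (1 / (n + 1))).toReal by rw [hs]; simp]
      refine ((ENNReal.tendsto_toReal (by rw [hs]; exact ENNReal.one_ne_top)).comp
        (tendsto_atTop_iSup fun m n hmn => ?_)).neg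
      exact propDist_anti hk t (Nat.one_div_le_one_div hmn)
    refine ge_of_tendsto' hlim fun n => ?_
    rw [← propagation_max_eq hk ht.le]
    exact hF.rightLim_le Nat.one_div_pos_of_nat
  have hres : hF.stieltjesFunction.measure.restrict (Ioi 0) = hF.stieltjesFunction.measure :=
    Measure.restrict_eq_self_of_ae_mem (by
      rw [ae_iff]; convert hatom using 2; ext x; simp)
  rw [propagationMeasure_eq hk ht.le, hres, ← expTransform, expTransform_stieltjes hF hFA hμ,
    relaxation]
  refine lintegral_congr fun τ => ?_
  congr 1
  rw [propagation_max_eq hk ht.le, sub_neg_eq_add, neg_add_eq_sub,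
    ENNReal.ofReal_sub _ ENNReal.toReal_nonneg, ENNReal.ofReal_one,
    ENNReal.ofReal_toReal (propDist_ne_top hk t τ)]

/-- The relaxation function is bounded from below by `k / (k + μ)`. -/
theorem ae_div_le_relaxation {μ : ℝ} (hμ : 0 < μ) :
    ∀ᵐ t : ℝ, 0 < t → ENNReal.ofReal (k t / (k t + μ)) ≤ relaxation hk μ t := by
  filter_upwards [ae_kernel_mul_coRelaxation_le hk hμ] with t h ht
  have h1 := h ht
  have h0 := hk.nonneg t ht
  have hadd := relaxation_add_coRelaxation hk hμ t
  have hs : relaxation hk μ t ≠ ∞ := fun h => by simp [h] at hadd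
  have hg : coRelaxation hk μ t ≠ ∞ := fun h => by simp [h] at hadd
  rw [← ENNReal.ofReal_toReal hs] at h1 hadd ⊢
  rw [← ENNReal.ofReal_toReal hg] at h1 hadd
  set s := (relaxation hk μ t).toReal
  set g := (coRelaxation hk μ t).toReal
  have hs0 : 0 ≤ s := ENNReal.toReal_nonneg
  have hg0 : 0 ≤ g := ENNReal.toReal_nonneg
  rw [← ENNReal.ofReal_add hs0 hg0, ENNReal.ofReal_eq_one] at hadd
  rw [← ENNReal.ofReal_mul h0, ← ENNReal.ofReal_mul hμ.le,
    ENNReal.ofReal_le_ofReal_iff (by positivity)] at h1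
  refine ENNReal.ofReal_le_ofReal ((div_le_iff₀ (by positivity)).2 ?_)
  nlinarith

end Relaxation

/-! ### Gaussian integrals and the heat semigroup. -/

section HeatKernel

variable {d : ℕ}

theorem heatKernel_nonneg {τ : ℝ} (hτ : 0 ≤ τ) (x : EuclideanSpace ℝ (Fin d)) :
    0 ≤ heatKernel τ x := by
  unfold heatKernel; positivity

theorem heatKernel_zero_le {τ b : ℝ} (hb : 0 < b) (h : b ≤ τ) (x : EuclideanSpace ℝ (Fin d)) :
    heatKernel τ x ≤ (4 * Real.pi * b) ^ (-((d : ℝ) / 2)) := by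
  unfold heatKernel
  have hp := Real.pi_pos
  have h1 : (4 * Real.pi * τ) ^ (-((d : ℝ) / 2)) ≤ (4 * Real.pi * b) ^ (-((d : ℝ) / 2)) := by
    refine Real.rpow_le_rpow_of_nonpos (by positivity) (by gcongr) ?_
    have : (0 : ℝ) ≤ d := Nat.cast_nonneg d
    linarith
  refine (mul_le_of_le_one_right (by have := hb.trans_le h; positivity) ?_).trans h1
  refine Real.exp_le_one_iff.2 (div_nonpos_of_nonpos_of_nonneg (by simp) ?_)
  linarith

theorem measurable_heatKernel :
    Measurable fun p : ℝ × EuclideanSpace ℝ (Fin d) => heatKernel p.1 p.2 := by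
  unfold heatKernel
  exact Measurable.mul ((by fun_prop : Measurable fun p : ℝ × EuclideanSpace ℝ (Fin d) =>
    4 * Real.pi * p.1).pow_const _) (by fun_prop)

theorem lintegral_exp_neg_mul_sq_norm {p : ℝ} (hp : 0 < p) :
    ∫⁻ x : EuclideanSpace ℝ (Fin d), ENNReal.ofReal (Real.exp (-p * ‖x‖ ^ 2))
      = ENNReal.ofReal ((Real.pi / p) ^ ((d : ℝ) / 2)) := by
  have h := GaussianFourier.integral_rexp_neg_mul_sq_norm (V := EuclideanSpace ℝ (Fin d)) hp
  rw [finrank_euclideanSpace_fin] at h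
  have hpos : 0 < (Real.pi / p) ^ ((d : ℝ) / 2) := by have := Real.pi_pos; positivity
  have hi : Integrable fun x : EuclideanSpace ℝ (Fin d) => Real.exp (-p * ‖x‖ ^ 2) := by
    by_contra hn
    rw [integral_undef hn] at h
    exact hpos.ne h
  rw [← h, ofReal_integral_eq_lintegral_ofReal hi (Eventually.of_forall fun x => Real.exp_nonneg _)]

/-- The semigroup law of the heat kernel. -/
theorem lintegral_heatKernel_mul {b τ : ℝ} (hb : 0 < b) (hτ : 0 < τ)
    (y : EuclideanSpace ℝ (Fin d)) :
    ∫⁻ x, ENNReal.ofReal (heatKernel b x) * ENNReal.ofReal (heatKernel τ (x - y))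
      = ENNReal.ofReal (heatKernel (τ + b) y) := by
  have hpi := Real.pi_pos
  -- Completing the square: the product of the two Gaussians is C times a Gaussian in x of rate p
  -- centred at q y.
  let p : ℝ := (τ + b) / (4 * τ * b)
  let q : ℝ := b / (τ + b)
  have hp : 0 < p := by positivity
  let C : ℝ := (4 * Real.pi * b) ^ (-((d : ℝ) / 2)) * (4 * Real.pi * τ) ^ (-((d : ℝ) / 2))
    * Real.exp (-‖y‖ ^ 2 / (4 * (τ + b)))
  have h1 : ∀ x : EuclideanSpace ℝ (Fin d),
      ENNReal.ofReal (heatKernel b x) * ENNReal.ofReal (heatKernel τ (x - y))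
      = ENNReal.ofReal C * ENNReal.ofReal (Real.exp (-p * ‖x - q • y‖ ^ 2)) := by
    intro x
    rw [← ENNReal.ofReal_mul (heatKernel_nonneg hb.le x), ← ENNReal.ofReal_mul (by positivity)]
    congr 1
    unfold heatKernel
    have he : Real.exp (-‖x‖ ^ 2 / (4 * b)) * Real.exp (-‖x - y‖ ^ 2 / (4 * τ))
        = Real.exp (-‖y‖ ^ 2 / (4 * (τ + b))) * Real.exp (-p * ‖x - q • y‖ ^ 2) := by
      rw [← Real.exp_add, ← Real.exp_add]
      congr 1
      rw [norm_sub_sq_real, norm_sub_sq_real, norm_smul, inner_smul_right, mul_pow,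
        Real.norm_eq_abs, sq_abs]
      simp only [p, q]
      field_simp
      ring
    calc _ = (4 * Real.pi * b) ^ (-((d : ℝ) / 2)) * (4 * Real.pi * τ) ^ (-((d : ℝ) / 2))
          * (Real.exp (-‖x‖ ^ 2 / (4 * b)) * Real.exp (-‖x - y‖ ^ 2 / (4 * τ))) := by ring
      _ = _ := by rw [he]; ring
  simp_rw [h1]
  rw [lintegral_const_mul _ (by fun_prop),
    lintegral_sub_right_eq_self (fun x : EuclideanSpace ℝ (Fin d) =>
      ENNReal.ofReal (Real.exp (-p * ‖x‖ ^ 2))) (q • y),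
    lintegral_exp_neg_mul_sq_norm hp, ← ENNReal.ofReal_mul (by positivity)]
  congr 1
  unfold heatKernel
  have hc : (4 * Real.pi * b) ^ (-((d : ℝ) / 2)) * (4 * Real.pi * τ) ^ (-((d : ℝ) / 2))
      * (Real.pi / p) ^ ((d : ℝ) / 2) = (4 * Real.pi * (τ + b)) ^ (-((d : ℝ) / 2)) := by
    rw [← Real.mul_rpow (by positivity) (by positivity), ← neg_neg ((d : ℝ) / 2),
      Real.rpow_neg (by positivity : (0 : ℝ) ≤ Real.pi / p), ← Real.inv_rpow (by positivity),
      neg_neg, ← Real.mul_rpow (by positivity) (by positivity)]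
    congr 1
    simp only [p]
    field_simp
  rw [← hc]; ring

theorem lintegral_heatKernel {τ : ℝ} (hτ : 0 < τ) :
    ∫⁻ x : EuclideanSpace ℝ (Fin d), ENNReal.ofReal (heatKernel τ x) = 1 := by
  have hpi := Real.pi_pos
  unfold heatKernel
  have : ∀ x : EuclideanSpace ℝ (Fin d),
      ENNReal.ofReal ((4 * Real.pi * τ) ^ (-((d : ℝ) / 2)) * Real.exp (-‖x‖ ^ 2 / (4 * τ)))
      = ENNReal.ofReal ((4 * Real.pi * τ) ^ (-((d : ℝ) / 2)))
        * ENNReal.ofReal (Real.exp (-(1 / (4 * τ)) * ‖x‖ ^ 2)) := by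
    intro x
    rw [← ENNReal.ofReal_mul (by positivity)]
    congr 3; ring
  simp_rw [this]
  rw [lintegral_const_mul _ (by fun_prop), lintegral_exp_neg_mul_sq_norm (by positivity),
    ← ENNReal.ofReal_mul (by positivity), Real.rpow_neg (by positivity),
    show Real.pi / (1 / (4 * τ)) = 4 * Real.pi * τ by field_simp, inv_mul_cancel₀ (by positivity),
    ENNReal.ofReal_one]

/-- Interpolation: H² is at most its supremum (4πb)^(-d/2) times H, and H has mass 1. -/
theorem eLpNorm_heatKernel_le {b : ℝ} (hb : 0 < b) :
    eLpNorm (fun x : EuclideanSpace ℝ (Fin d) => heatKernel b x) 2 volume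
      ≤ ENNReal.ofReal ((4 * Real.pi * b) ^ (-((d : ℝ) / 4))) := by
  have hpi := Real.pi_pos
  rw [eLpNorm_eq_lintegral_rpow_enorm_toReal (by simp) (by simp), ENNReal.toReal_ofNat]
  have h1 : ∫⁻ x : EuclideanSpace ℝ (Fin d), ‖heatKernel b x‖ₑ ^ (2 : ℝ)
      ≤ ENNReal.ofReal ((4 * Real.pi * b) ^ (-((d : ℝ) / 2))) := by
    rw [← mul_one (ENNReal.ofReal _), ← lintegral_heatKernel (d := d) hb, ← lintegral_const_mul]
    · refine lintegral_mono fun x => ?_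
      rw [Real.enorm_of_nonneg (heatKernel_nonneg hb.le x), ENNReal.rpow_two, sq]
      exact mul_le_mul_left (ENNReal.ofReal_le_ofReal (heatKernel_zero_le hb le_rfl x)) _
    · exact (measurable_heatKernel.comp (measurable_const.prodMk measurable_id)).ennreal_ofReal
  calc _ ≤ ENNReal.ofReal ((4 * Real.pi * b) ^ (-((d : ℝ) / 2))) ^ (1 / (2 : ℝ)) :=
        ENNReal.rpow_le_rpow h1 (by norm_num)
    _ = _ := by
        rw [ENNReal.ofReal_rpow_of_nonneg (by positivity) (by norm_num),
          ← Real.rpow_mul (by positivity)]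
        congr 2; ring

end HeatKernel

/-! ### Young's inequality. -/

section Convolution

variable {d : ℕ}

/-- **Young's inequality** `‖Z * v‖₂ ≤ ‖Z‖₁ ‖v‖₂` for `‖Z‖₁ ≤ 1`. -/
theorem memLp_two_convolution {Z : EuclideanSpace ℝ (Fin d) → ℝ} (hZ : Measurable Z)
    (hZ1 : ∫⁻ x, ‖Z x‖ₑ ≤ 1) {v : EuclideanSpace ℝ (Fin d) → ℂ} (hv : MemLp v 2 volume) :
    MemLp (fun x => ∫ y, Z (x - y) • v y) 2 volume := by
  have hvm : AEStronglyMeasurable v volume := hv.1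
  have hjm : AEStronglyMeasurable (fun p : EuclideanSpace ℝ (Fin d) × EuclideanSpace ℝ (Fin d) =>
      Z (p.1 - p.2) • v p.2) (volume.prod volume) :=
    ((hZ.comp (measurable_fst.sub measurable_snd)).aestronglyMeasurable).smul hvm.comp_snd
  refine ⟨hjm.integral_prod_right', ?_⟩
  rw [eLpNorm_lt_top_iff_lintegral_rpow_enorm_lt_top (by simp) (by simp), ENNReal.toReal_ofNat]
  have hv2 := (eLpNorm_lt_top_iff_lintegral_rpow_enorm_lt_top (by simp) (by simp)).1 hv.2
  rw [ENNReal.toReal_ofNat] at hv2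
  have hpt : ∀ x, ‖∫ y, Z (x - y) • v y‖ₑ ^ (2 : ℝ)
      ≤ ∫⁻ y, ‖Z (x - y)‖ₑ * ‖v y‖ₑ ^ (2 : ℝ) := by
    intro x
    have hZx : AEMeasurable (fun y => ‖Z (x - y)‖ₑ) volume :=
      (hZ.comp (measurable_const.sub measurable_id)).enorm.aemeasurable
    -- The factorization |Z| |v| = |Z|^(1/2) (|Z| |v|²)^(1/2) prepares Cauchy–Schwarz.
    have h1 : ‖∫ y, Z (x - y) • v y‖ₑ ≤ ∫⁻ y, ‖Z (x - y)‖ₑ ^ (1 / 2 : ℝ)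
        * (‖Z (x - y)‖ₑ * ‖v y‖ₑ ^ (2 : ℝ)) ^ (1 / 2 : ℝ) := by
      refine (enorm_integral_le_lintegral_enorm _).trans (lintegral_mono fun y => le_of_eq ?_)
      rw [ENNReal.mul_rpow_of_nonneg _ _ (by norm_num), ← ENNReal.rpow_mul, ← mul_assoc,
        ← ENNReal.rpow_add_of_nonneg _ _ (by norm_num) (by norm_num), enorm_smul]
      norm_num
    have h2 := ENNReal.lintegral_mul_norm_pow_le hZx (hZx.mul (hvm.enorm.pow_const (2 : ℝ)))
      (p := 1 / 2) (q := 1 / 2) (by norm_num) (by norm_num) (by norm_num)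
    have h3 : (∫⁻ y, ‖Z (x - y)‖ₑ) ≤ 1 := by
      rw [lintegral_sub_left_eq_self (fun y => ‖Z y‖ₑ) x]; exact hZ1
    calc _ ≤ ((∫⁻ y, ‖Z (x - y)‖ₑ * ‖v y‖ₑ ^ (2 : ℝ)) ^ (1 / 2 : ℝ)) ^ (2 : ℝ) := by
          refine ENNReal.rpow_le_rpow (h1.trans (h2.trans ?_)) (by norm_num)
          exact mul_le_of_le_one_left' (ENNReal.rpow_le_one h3 (by norm_num))
      _ = _ := by rw [← ENNReal.rpow_mul]; norm_num
  calc ∫⁻ x, ‖∫ y, Z (x - y) • v y‖ₑ ^ (2 : ℝ)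
      ≤ ∫⁻ x, ∫⁻ y, ‖Z (x - y)‖ₑ * ‖v y‖ₑ ^ (2 : ℝ) := lintegral_mono hpt
    _ = ∫⁻ y, ∫⁻ x, ‖Z (x - y)‖ₑ * ‖v y‖ₑ ^ (2 : ℝ) := by
        refine lintegral_lintegral_swap (f := fun x y => ‖Z (x - y)‖ₑ * ‖v y‖ₑ ^ (2 : ℝ)) ?_
        exact ((hZ.comp (measurable_fst.sub measurable_snd)).enorm.aemeasurable).mul
          (hvm.comp_snd.enorm.pow_const (2 : ℝ))
    _ = ∫⁻ y, (∫⁻ x, ‖Z x‖ₑ) * ‖v y‖ₑ ^ (2 : ℝ) := by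
        refine lintegral_congr fun y => ?_
        have hZy : Measurable fun x => ‖Z (x - y)‖ₑ :=
          (hZ.comp (measurable_id.sub measurable_const)).enorm
        rw [lintegral_mul_const _ hZy]
        congr 1
        exact lintegral_sub_right_eq_self (fun x => ‖Z x‖ₑ) y
    _ ≤ ∫⁻ y, ‖v y‖ₑ ^ (2 : ℝ) := lintegral_mono fun y => mul_le_of_le_one_left' hZ1
    _ < ∞ := hv2

end Convolution

/-! ### Testing the subordinated evolution against a Gaussian. -/

section Subordination

variable {d : ℕ}

/-- The heat kernel subordinated by a measure, with values in `[0, ∞]`. -/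
def subordinatedHeat (m : Measure ℝ) (x : EuclideanSpace ℝ (Fin d)) : ℝ≥0∞ :=
  ∫⁻ τ in Ioi 0, ENNReal.ofReal (heatKernel τ x) ∂m

/-- The subordinated heat kernel, shifted by the time `b`. -/
def shiftedHeat (m : Measure ℝ) (b : ℝ) (y : EuclideanSpace ℝ (Fin d)) : ℝ :=
  ∫ τ in Ioi 0, heatKernel (τ + b) y ∂m

/-- This holds also where the integral diverges (possibly at x = 0): the Bochner integral and
`toReal ∞` both default to 0. -/
theorem integral_heatKernel_eq_toReal (m : Measure ℝ) (x : EuclideanSpace ℝ (Fin d)) :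
    ∫ τ in Ioi 0, heatKernel τ x ∂m = (subordinatedHeat m x).toReal := by
  rw [subordinatedHeat, integral_eq_lintegral_of_nonneg_ae]
  · filter_upwards [ae_restrict_mem measurableSet_Ioi] with τ hτ
    exact heatKernel_nonneg (le_of_lt hτ) x
  · exact (measurable_heatKernel.comp
      (measurable_id.prodMk measurable_const)).aestronglyMeasurable

variable {m : Measure ℝ}

theorem measurable_subordinatedHeat [SFinite m] :
    Measurable (subordinatedHeat m : EuclideanSpace ℝ (Fin d) → ℝ≥0∞) := by
  refine Measurable.lintegral_prod_right' (f := fun p : EuclideanSpace ℝ (Fin d) × ℝ =>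
    ENNReal.ofReal (heatKernel p.2 p.1)) ?_
  exact (measurable_heatKernel.comp measurable_swap).ennreal_ofReal

theorem lintegral_subordinatedHeat_le [SFinite m] (hm : m univ ≤ 1) :
    ∫⁻ x : EuclideanSpace ℝ (Fin d), subordinatedHeat m x ≤ 1 := by
  unfold subordinatedHeat
  rw [lintegral_lintegral_swap (f := fun (x : EuclideanSpace ℝ (Fin d)) τ =>
    ENNReal.ofReal (heatKernel τ x))
    (measurable_heatKernel.comp measurable_swap).ennreal_ofReal.aemeasurable]
  rw [setLIntegral_congr_fun measurableSet_Ioi (g := fun _ => 1)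
    fun τ hτ => lintegral_heatKernel hτ, setLIntegral_const, one_mul]
  exact (measure_mono (subset_univ _)).trans hm

theorem lintegral_enorm_toReal_le [SFinite m] (hm : m univ ≤ 1) :
    ∫⁻ x : EuclideanSpace ℝ (Fin d), ‖(subordinatedHeat m x).toReal‖ₑ ≤ 1 := by
  refine (lintegral_mono fun x => ?_).trans (lintegral_subordinatedHeat_le hm)
  rw [Real.enorm_of_nonneg ENNReal.toReal_nonneg]
  exact ENNReal.ofReal_toReal_le

theorem measurable_toReal_subordinatedHeat [SFinite m] :
    Measurable fun x : EuclideanSpace ℝ (Fin d) => (subordinatedHeat m x).toReal :=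
  measurable_subordinatedHeat.ennreal_toReal

theorem integrable_toReal_subordinatedHeat [SFinite m] (hm : m univ ≤ 1) :
    Integrable fun x : EuclideanSpace ℝ (Fin d) => (subordinatedHeat m x).toReal :=
  ⟨measurable_toReal_subordinatedHeat.aestronglyMeasurable,
    (lintegral_enorm_toReal_le hm).trans_lt ENNReal.one_lt_top⟩

theorem measurable_heatKernel_add (b : ℝ) (y : EuclideanSpace ℝ (Fin d)) :
    Measurable fun τ : ℝ => heatKernel (τ + b) y :=
  measurable_heatKernel.comp ((measurable_add_const b).prodMk measurable_const)

/-- Tonelli and the semigroup law for each τ. Points where the subordinated kernel is infinite form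
a null set, because its integral is at most 1. -/
theorem integral_heatKernel_mul_subordinatedHeat [SFinite m] (hm : m univ ≤ 1) {b : ℝ}
    (hb : 0 < b) (y : EuclideanSpace ℝ (Fin d)) :
    ∫ x, heatKernel b x * (subordinatedHeat m (x - y)).toReal = shiftedHeat m b y := by
  have hmb : Measurable fun x : EuclideanSpace ℝ (Fin d) => heatKernel b x :=
    measurable_heatKernel.comp (measurable_const.prodMk measurable_id)
  rw [shiftedHeat, integral_eq_lintegral_of_nonneg_ae, integral_eq_lintegral_of_nonneg_ae]
  · congr 1
    have hfin : ∀ᵐ x : EuclideanSpace ℝ (Fin d), subordinatedHeat m x < ∞ :=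
      ae_lt_top measurable_subordinatedHeat
        ((lintegral_subordinatedHeat_le hm).trans_lt ENNReal.one_lt_top).ne
    have hfin' : ∀ᵐ x : EuclideanSpace ℝ (Fin d), subordinatedHeat m (x - y) < ∞ :=
      (measurePreserving_sub_right volume y).quasiMeasurePreserving.ae hfin
    calc _ = ∫⁻ x, ∫⁻ τ in Ioi 0, ENNReal.ofReal (heatKernel b x)
          * ENNReal.ofReal (heatKernel τ (x - y)) ∂m := by
          refine lintegral_congr_ae ?_
          filter_upwards [hfin'] with x hx
          rw [ENNReal.ofReal_mul (heatKernel_nonneg hb.le x), ENNReal.ofReal_toReal hx.ne,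
            subordinatedHeat, lintegral_const_mul]
          exact (measurable_heatKernel.comp
            (measurable_id.prodMk measurable_const)).ennreal_ofReal
      _ = ∫⁻ τ in Ioi 0, (∫⁻ x, ENNReal.ofReal (heatKernel b x)
          * ENNReal.ofReal (heatKernel τ (x - y))) ∂m := by
          refine lintegral_lintegral_swap (f := fun (x : EuclideanSpace ℝ (Fin d)) τ =>
            ENNReal.ofReal (heatKernel b x) * ENNReal.ofReal (heatKernel τ (x - y))) ?_
          refine Measurable.aemeasurable (Measurable.mul (hmb.comp measurable_fst).ennreal_ofReal ?_)
          exact (measurable_heatKernel.comp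
            (measurable_snd.prodMk (measurable_fst.sub_const y))).ennreal_ofReal
      _ = _ := setLIntegral_congr_fun measurableSet_Ioi fun τ hτ =>
          lintegral_heatKernel_mul hb hτ y
  · filter_upwards [ae_restrict_mem measurableSet_Ioi] with τ hτ
    exact heatKernel_nonneg (add_pos hτ hb).le y
  · exact (measurable_heatKernel_add b y).aestronglyMeasurable
  · exact Eventually.of_forall fun x =>
      mul_nonneg (heatKernel_nonneg hb.le x) ENNReal.toReal_nonneg
  · exact (hmb.mul (measurable_toReal_subordinatedHeat.comp
      (measurable_id.sub_const y))).aestronglyMeasurable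

theorem integral_heatKernel_smul_convolution [SFinite m] (hm : m univ ≤ 1) {b : ℝ} (hb : 0 < b)
    {v : EuclideanSpace ℝ (Fin d) → ℂ} (hv : Integrable v) :
    ∫ x, heatKernel b x • ∫ y, (subordinatedHeat m (x - y)).toReal • v y
      = ∫ y, shiftedHeat m b y • v y := by
  have hmb : Measurable fun x : EuclideanSpace ℝ (Fin d) => heatKernel b x :=
    measurable_heatKernel.comp (measurable_const.prodMk measurable_id)
  have hi := hv.convolution_integrand (ContinuousLinearMap.lsmul ℝ ℝ).flip
    (integrable_toReal_subordinatedHeat (d := d) hm)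
  have hi2 : Integrable (fun p : EuclideanSpace ℝ (Fin d) × EuclideanSpace ℝ (Fin d) =>
      heatKernel b p.1 • ((subordinatedHeat m (p.1 - p.2)).toReal • v p.2))
      (volume.prod volume) := by
    refine Integrable.bdd_smul ?_ ((4 * Real.pi * b) ^ (-((d : ℝ) / 2)))
      (hmb.comp measurable_fst).aestronglyMeasurable (Eventually.of_forall fun p => ?_)
    · simpa using hi
    · simp only [Function.comp]
      rw [Real.norm_of_nonneg (heatKernel_nonneg hb.le _)]
      exact heatKernel_zero_le hb le_rfl _
  calc _ = ∫ x, ∫ y, heatKernel b x • ((subordinatedHeat m (x - y)).toReal • v y) := by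
        refine integral_congr_ae (Eventually.of_forall fun x => ?_)
        exact (integral_smul _ _).symm
    _ = ∫ y, ∫ x, heatKernel b x • ((subordinatedHeat m (x - y)).toReal • v y) :=
        integral_integral_swap hi2
    _ = _ := by
        refine integral_congr_ae (Eventually.of_forall fun y => ?_)
        simp only
        rw [← integral_heatKernel_mul_subordinatedHeat hm hb y, ← integral_smul_const]
        simp_rw [smul_smul]

theorem integrable_heatKernel_add [IsFiniteMeasure m] {b : ℝ} (hb : 0 < b)
    (y : EuclideanSpace ℝ (Fin d)) :
    IntegrableOn (fun τ => heatKernel (τ + b) y) (Ioi 0) m := by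
  refine Integrable.of_bound (measurable_heatKernel_add b y).aestronglyMeasurable
    ((4 * Real.pi * b) ^ (-((d : ℝ) / 2))) ?_
  filter_upwards [ae_restrict_mem measurableSet_Ioi] with τ (hτ : 0 < τ)
  rw [Real.norm_of_nonneg (heatKernel_nonneg (by positivity) _)]
  exact heatKernel_zero_le hb (by linarith) _

theorem shiftedHeat_nonneg {b : ℝ} (hb : 0 < b) (y : EuclideanSpace ℝ (Fin d)) :
    0 ≤ shiftedHeat m b y :=
  setIntegral_nonneg measurableSet_Ioi fun _ hτ => heatKernel_nonneg (add_pos hτ hb).le y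

/-- Far from the initial time the shifted kernel is almost constant in space. -/
theorem abs_shiftedHeat_sub_le [IsFiniteMeasure m] {b : ℝ} (hb : 0 < b)
    (y : EuclideanSpace ℝ (Fin d)) :
    |shiftedHeat m b y - shiftedHeat m b (0 : EuclideanSpace ℝ (Fin d))|
      ≤ shiftedHeat m b (0 : EuclideanSpace ℝ (Fin d))
        * (1 - Real.exp (-‖y‖ ^ 2 / (4 * b))) := by
  have hi := integrable_heatKernel_add (m := m) hb y
  have hi0 := integrable_heatKernel_add (m := m) hb (0 : EuclideanSpace ℝ (Fin d))
  unfold shiftedHeat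
  rw [← integral_sub hi hi0, ← integral_mul_const]
  refine (abs_integral_le_integral_abs).trans ?_
  refine integral_mono_ae (hi.sub hi0).abs (hi0.mul_const _) ?_
  filter_upwards [ae_restrict_mem measurableSet_Ioi] with τ (hτ : 0 < τ)
  have hpi := Real.pi_pos
  have h1 : Real.exp (-‖y‖ ^ 2 / (4 * (τ + b))) ≤ 1 :=
    Real.exp_le_one_iff.2 (div_nonpos_of_nonpos_of_nonneg (by simp) (by positivity))
  -- The heat time τ + b is at least b, which makes the relative error independent of τ and hence of
  -- m.
  have h2 : Real.exp (-‖y‖ ^ 2 / (4 * b)) ≤ Real.exp (-‖y‖ ^ 2 / (4 * (τ + b))) := by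
    refine Real.exp_le_exp.2 ?_
    rw [neg_div, neg_div, neg_le_neg_iff]
    gcongr
    linarith
  have hc : 0 ≤ (4 * Real.pi * (τ + b)) ^ (-((d : ℝ) / 2)) := by positivity
  simp only [heatKernel, norm_zero]
  rw [abs_sub_comm, ← mul_sub, abs_mul, abs_of_nonneg hc]
  simp only [ne_eq, OfNat.ofNat_ne_zero, not_false_eq_true, zero_pow, neg_zero, zero_div,
    Real.exp_zero, mul_one]
  rw [abs_of_nonneg (by linarith)]
  exact mul_le_mul_of_nonneg_left (by linarith) hc

/-- A lower bound for the shifted kernel at the origin by a Laplace transform. -/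
theorem le_shiftedHeat_zero [IsFiniteMeasure m] {b : ℝ} (hb : 0 < b) :
    ENNReal.ofReal ((4 * Real.pi * b) ^ (-((d : ℝ) / 2))) *
        ∫⁻ τ in Ioi 0, ENNReal.ofReal (Real.exp (-((d : ℝ) / (2 * b)) * τ)) ∂m
      ≤ ENNReal.ofReal (shiftedHeat m b (0 : EuclideanSpace ℝ (Fin d))) := by
  have hpi := Real.pi_pos
  rw [shiftedHeat, ofReal_integral_eq_lintegral_ofReal
    (integrable_heatKernel_add hb (0 : EuclideanSpace ℝ (Fin d))),
    ← lintegral_const_mul _ (by fun_prop)]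
  · refine lintegral_mono_ae ?_
    filter_upwards [ae_restrict_mem measurableSet_Ioi] with τ (hτ : 0 < τ)
    rw [← ENNReal.ofReal_mul (by positivity)]
    refine ENNReal.ofReal_le_ofReal ?_
    simp only [heatKernel, norm_zero, ne_eq, OfNat.ofNat_ne_zero, not_false_eq_true, zero_pow,
      neg_zero, zero_div, Real.exp_zero, mul_one]
    -- From 1 + τ/b ≤ e^(τ/b); raised to the power -d/2 this produces the rate d/(2b).
    have h1 : 4 * Real.pi * (τ + b) ≤ 4 * Real.pi * b * Real.exp (τ / b) := by
      have := Real.add_one_le_exp (τ / b)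
      calc 4 * Real.pi * (τ + b) = 4 * Real.pi * b * (τ / b + 1) := by field_simp
        _ ≤ _ := by gcongr
    calc (4 * Real.pi * b) ^ (-((d : ℝ) / 2)) * Real.exp (-((d : ℝ) / (2 * b)) * τ)
        = (4 * Real.pi * b * Real.exp (τ / b)) ^ (-((d : ℝ) / 2)) := by
          rw [Real.mul_rpow (by positivity) (Real.exp_nonneg _), ← Real.exp_mul]
          congr 2; field_simp
      _ ≤ _ := Real.rpow_le_rpow_of_nonpos (by positivity) h1 (by
          have : (0 : ℝ) ≤ d := Nat.cast_nonneg d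
          linarith)
  · filter_upwards [ae_restrict_mem measurableSet_Ioi] with τ hτ
    exact heatKernel_nonneg (add_pos hτ hb).le _

/-- The factor 1 - exp(-|y|²/(4b)) is the relative oscillation of the shifted kernel. Dominated
convergence makes its weighted integral small at a scale depending on v alone, so the same b serves
all t. -/
theorem exists_forall_integral_one_sub_exp_le {v : EuclideanSpace ℝ (Fin d) → ℂ}
    (hv : Integrable v) {ε : ℝ} (hε : 0 < ε) :
    ∃ B : ℝ, 1 ≤ B ∧ ∀ b, B ≤ b → ∫ y, (1 - Real.exp (-‖y‖ ^ 2 / (4 * b))) * ‖v y‖ ≤ ε := by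
  have hlim : Tendsto (fun b : ℝ => ∫ y, (1 - Real.exp (-‖y‖ ^ 2 / (4 * b))) * ‖v y‖) atTop
      (𝓝 (∫ _ : EuclideanSpace ℝ (Fin d), (0 : ℝ))) := by
    refine tendsto_integral_filter_of_dominated_convergence (fun y => ‖v y‖)
      (Eventually.of_forall fun b => ?_) ?_ hv.norm (Eventually.of_forall fun y => ?_)
    · exact AEStronglyMeasurable.mul (Measurable.aestronglyMeasurable (by fun_prop)) hv.1.norm
    · filter_upwards [eventually_gt_atTop 0] with b hb
      refine Eventually.of_forall fun y => ?_
      have h1 : Real.exp (-‖y‖ ^ 2 / (4 * b)) ≤ 1 :=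
        Real.exp_le_one_iff.2 (div_nonpos_of_nonpos_of_nonneg (by simp) (by positivity))
      rw [norm_mul, norm_norm, Real.norm_of_nonneg (by linarith)]
      exact mul_le_of_le_one_left (norm_nonneg _) (by linarith [Real.exp_nonneg (-‖y‖ ^ 2 / (4 * b))])
    · have h1 : Tendsto (fun b : ℝ => -‖y‖ ^ 2 / (4 * b)) atTop (𝓝 0) :=
        tendsto_const_nhds.div_atTop (tendsto_id.const_mul_atTop (by norm_num))
      have h2 := ((Real.continuous_exp.tendsto 0).comp h1).const_sub 1
      simpa using h2.mul_const ‖v y‖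
  rw [integral_zero] at hlim
  obtain ⟨B, hB⟩ := eventually_atTop.1 (hlim.eventually (eventually_le_nhds hε))
  exact ⟨max B 1, le_max_right _ _, fun b hb => hB b ((le_max_left _ _).trans hb)⟩

theorem measurable_shiftedHeat [SFinite m] (b : ℝ) :
    StronglyMeasurable (shiftedHeat m b : EuclideanSpace ℝ (Fin d) → ℝ) := by
  refine StronglyMeasurable.integral_prod_right' (f := fun p : EuclideanSpace ℝ (Fin d) × ℝ =>
    heatKernel (p.2 + b) p.1) ?_
  exact (measurable_heatKernel.comp
    ((measurable_snd.add_const b).prodMk measurable_fst)).stronglyMeasurable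

/-- Replacing the kernel by its value A at the origin costs at most A times the weighted
oscillation, that is, half of the main term A |∫ v|. -/
theorem shiftedHeat_zero_mul_le [IsFiniteMeasure m] {b : ℝ} (hb : 0 < b)
    {v : EuclideanSpace ℝ (Fin d) → ℂ} (hv : Integrable v)
    (hR : ∫ y, (1 - Real.exp (-‖y‖ ^ 2 / (4 * b))) * ‖v y‖ ≤ ‖∫ y, v y‖ / 2) :
    shiftedHeat m b (0 : EuclideanSpace ℝ (Fin d)) * (‖∫ y, v y‖ / 2)
      ≤ ‖∫ y, shiftedHeat m b y • v y‖ := by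
  set A := shiftedHeat m b (0 : EuclideanSpace ℝ (Fin d)) with hA
  have hA0 : 0 ≤ A := shiftedHeat_nonneg hb _
  have he : ∀ y : EuclideanSpace ℝ (Fin d), 0 ≤ 1 - Real.exp (-‖y‖ ^ 2 / (4 * b)) ∧
      1 - Real.exp (-‖y‖ ^ 2 / (4 * b)) ≤ 1 := fun y => by
    have h1 : Real.exp (-‖y‖ ^ 2 / (4 * b)) ≤ 1 :=
      Real.exp_le_one_iff.2 (div_nonpos_of_nonpos_of_nonneg (by simp) (by positivity))
    have := Real.exp_nonneg (-‖y‖ ^ 2 / (4 * b))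
    constructor <;> linarith
  have hd : Integrable fun y => (shiftedHeat m b y - A) • v y := by
    refine Integrable.bdd_smul hv A
      ((measurable_shiftedHeat b).sub stronglyMeasurable_const).aestronglyMeasurable
      (Eventually.of_forall fun y => ?_)
    exact (abs_shiftedHeat_sub_le hb y).trans (mul_le_of_le_one_right hA0 (he y).2)
  have hAv : Integrable fun y => A • v y := hv.smul A
  have hsplit : ∫ y, shiftedHeat m b y • v y
      = (∫ y, (shiftedHeat m b y - A) • v y) + A • ∫ y, v y := by
    rw [← integral_smul, ← integral_add hd hAv]
    refine integral_congr_ae (Eventually.of_forall fun y => ?_)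
    simp only [sub_smul, sub_add_cancel]
  have hw : Integrable fun y => A * ((1 - Real.exp (-‖y‖ ^ 2 / (4 * b))) * ‖v y‖) := by
    refine Integrable.const_mul ?_ A
    refine Integrable.bdd_mul (c := 1) hv.norm
      (Measurable.aestronglyMeasurable (by fun_prop)) (Eventually.of_forall fun y => ?_)
    rw [Real.norm_of_nonneg (he y).1]
    exact (he y).2
  have hbound : ‖∫ y, (shiftedHeat m b y - A) • v y‖ ≤ A * (‖∫ y, v y‖ / 2) := by
    calc _ ≤ ∫ y, ‖(shiftedHeat m b y - A) • v y‖ := norm_integral_le_integral_norm _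
      _ ≤ ∫ y, A * ((1 - Real.exp (-‖y‖ ^ 2 / (4 * b))) * ‖v y‖) := by
          refine integral_mono hd.norm hw fun y => ?_
          simp only
          rw [norm_smul, ← mul_assoc]
          exact mul_le_mul_of_nonneg_right (abs_shiftedHeat_sub_le hb y) (norm_nonneg _)
      _ ≤ _ := by
          rw [integral_const_mul]
          exact mul_le_mul_of_nonneg_left hR hA0
  have h1 : ‖A • ∫ y, v y‖ = A * ‖∫ y, v y‖ := by rw [norm_smul, Real.norm_of_nonneg hA0]
  have h2 := norm_sub_le_norm_add (A • ∫ y, v y) (∫ y, (shiftedHeat m b y - A) • v y)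
  rw [hsplit, add_comm]
  linarith

/-- Testing the subordinated evolution against a Gaussian of variance `b`. -/
theorem le_eLpNorm_convolution (hm : m univ ≤ 1) {b : ℝ} (hb : 0 < b)
    {v : EuclideanSpace ℝ (Fin d) → ℂ} (hv : Integrable v) (hv2 : MemLp v 2 volume)
    (hR : ∫ y, (1 - Real.exp (-‖y‖ ^ 2 / (4 * b))) * ‖v y‖ ≤ ‖∫ y, v y‖ / 2)
    {r : ℝ} (hmr : ENNReal.ofReal r
      ≤ ∫⁻ τ in Ioi 0, ENNReal.ofReal (Real.exp (-((d : ℝ) / (2 * b)) * τ)) ∂m) :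
    ‖∫ y, v y‖ / 2 * (4 * Real.pi * b) ^ (-((d : ℝ) / 4)) * r ≤
      (eLpNorm (fun x => ∫ y, (subordinatedHeat m (x - y)).toReal • v y) 2 volume).toReal := by
  have hpi := Real.pi_pos
  have : IsFiniteMeasure m := ⟨hm.trans_lt ENNReal.one_lt_top⟩
  have hu := memLp_two_convolution (d := d) measurable_toReal_subordinatedHeat
    (lintegral_enorm_toReal_le hm) hv2
  set u : EuclideanSpace ℝ (Fin d) → ℂ :=
    fun x => ∫ y, (subordinatedHeat m (x - y)).toReal • v y with hu_def
  have hmb : Measurable fun x : EuclideanSpace ℝ (Fin d) => heatKernel b x :=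
    measurable_heatKernel.comp (measurable_const.prodMk measurable_id)
  set c := (4 * Real.pi * b) ^ (-((d : ℝ) / 4)) with hc
  have hc0 : 0 < c := by positivity
  set N := (eLpNorm u 2 volume).toReal with hN
  have hup : ‖∫ x, heatKernel b x • u x‖ ≤ c * N := by
    have h1 : ‖∫ x, heatKernel b x • u x‖ₑ ≤ ENNReal.ofReal c * eLpNorm u 2 volume := by
      refine (enorm_integral_le_lintegral_enorm _).trans ?_
      rw [← eLpNorm_one_eq_lintegral_enorm]
      refine (eLpNorm_smul_le_mul_eLpNorm (p := 2) (q := 2) (r := 1) hu.1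
        hmb.aestronglyMeasurable).trans ?_
      exact mul_le_mul_left (eLpNorm_heatKernel_le hb) _
    rw [← toReal_enorm, hN, ← ENNReal.toReal_ofReal hc0.le, ← ENNReal.toReal_mul]
    exact ENNReal.toReal_mono (ENNReal.mul_ne_top ENNReal.ofReal_ne_top hu.2.ne) h1
  rw [integral_heatKernel_smul_convolution hm hb hv] at hup
  have hlow := (shiftedHeat_zero_mul_le (m := m) hb hv hR).trans hup
  -- The kernel at the origin carries (4πb)^(-d/2) = c²; one factor c is lost to the norm of the
  -- test function.
  have hA : c * c * r ≤ shiftedHeat m b (0 : EuclideanSpace ℝ (Fin d)) := by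
    have h2 := le_shiftedHeat_zero (d := d) (m := m) hb
    have hcc : (4 * Real.pi * b) ^ (-((d : ℝ) / 2)) = c * c := by
      rw [hc, ← Real.rpow_add (by positivity)]
      congr 1; ring
    rw [hcc] at h2
    have h3 := (mul_le_mul_right hmr (ENNReal.ofReal (c * c))).trans h2
    rw [← ENNReal.ofReal_mul (by positivity)] at h3
    exact (ENNReal.ofReal_le_ofReal_iff (shiftedHeat_nonneg hb _)).1 h3
  have h4 : c * c * r * (‖∫ y, v y‖ / 2) ≤ c * N :=
    (mul_le_mul_of_nonneg_right hA (by positivity)).trans hlow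
  refine le_of_mul_le_mul_left ?_ hc0
  calc _ = c * c * r * (‖∫ y, v y‖ / 2) := by ring
    _ ≤ _ := h4

end Subordination

/-! ### Choice of the scale and conclusion. -/

theorem fourier_zero {d : ℕ} (v : EuclideanSpace ℝ (Fin d) → ℂ) : fourier v 0 = ∫ x, v x := by
  simp [fourier]

theorem solution_eq {d : ℕ} (k : ℝ → ℝ) (v : EuclideanSpace ℝ (Fin d) → ℂ) (t : ℝ) :
    solution k v t
      = fun x => ∫ y, (subordinatedHeat (propagationMeasure k t) (x - y)).toReal • v y := by
  ext x
  simp only [solution, fundamentalSolution, integral_heatKernel_eq_toReal]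

/-- The lower bound for the solution with a free scale `b` of the test function. -/
theorem ae_le_eLpNorm_solution {d : ℕ} (hd : 1 ≤ d) {k : ℝ → ℝ} (hk : IsDecreasingKernel k)
    {v : EuclideanSpace ℝ (Fin d) → ℂ} (hv : Integrable v) (hv2 : MemLp v 2 volume)
    (hv0 : ∫ y, v y ≠ 0) :
    ∃ N : ℕ, 1 ≤ N ∧ ∀ᵐ t : ℝ, 0 < t → ∀ b : ℕ, N ≤ b →
      ‖∫ y, v y‖ / 2 * (4 * Real.pi * b) ^ (-((d : ℝ) / 4)) * (k t / (k t + d / (2 * b)))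
        ≤ (eLpNorm (solution k v t) 2 volume).toReal := by
  obtain ⟨B, hB1, hB⟩ := exists_forall_integral_one_sub_exp_le hv
    (half_pos (norm_pos_iff.2 hv0))
  obtain ⟨N, hN⟩ := exists_nat_ge B
  have hd0 : (0 : ℝ) < d := by exact_mod_cast hd
  refine ⟨N, by exact_mod_cast hB1.trans hN, ?_⟩
  -- Scales are restricted to integers so that a single null set of t serves all of them; b may then
  -- depend on t.
  have hall : ∀ᵐ t : ℝ, ∀ b : ℕ, N ≤ b → 0 < t →
      ENNReal.ofReal (k t / (k t + d / (2 * b))) ≤ relaxation hk (d / (2 * b)) t := by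
    refine ae_all_iff.2 fun b => ?_
    by_cases hb : N ≤ b
    · have hb0 : (0 : ℝ) < b := by
        have : (N : ℝ) ≤ b := by exact_mod_cast hb
        linarith
      filter_upwards [ae_div_le_relaxation hk (μ := d / (2 * b)) (by positivity)] with t ht _
        using ht
    · exact Eventually.of_forall fun t h => absurd h hb
  filter_upwards [hall, ae_lintegral_propagationMeasure hk] with t h1 h2 ht b hb
  have hNb : (N : ℝ) ≤ b := by exact_mod_cast hb
  have hb0 : (0 : ℝ) < b := by linarith
  have hk0 := hk.nonneg t ht
  rw [solution_eq]
  refine le_eLpNorm_convolution (propagationMeasure_univ_le hk ht.le) hb0 hv hv2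
    (hB b (hN.trans hNb)) ?_
  rw [h2 ht _ (by positivity)]
  exact h1 b hb ht

theorem memLp_solution {d : ℕ} {k : ℝ → ℝ} (hk : IsDecreasingKernel k)
    {v : EuclideanSpace ℝ (Fin d) → ℂ} (hv2 : MemLp v 2 volume) {t : ℝ} (ht : 0 ≤ t) :
    MemLp (solution k v t) 2 volume := by
  have hm := propagationMeasure_univ_le hk ht
  have : IsFiniteMeasure (propagationMeasure k t) := ⟨hm.trans_lt ENNReal.one_lt_top⟩
  rw [solution_eq]
  exact memLp_two_convolution measurable_toReal_subordinatedHeat (lintegral_enorm_toReal_le hm) hv2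

/-- A fixed test function gives decay at most like `κ`. -/
theorem fixed_scale_bound {κ K U P D : ℝ} (hκ : 0 ≤ κ) (hκK : κ ≤ K) (hU : 0 < U)
    (hP : 0 < P) (hD : 0 < D) :
    U * P / (K + D) * κ ≤ U * P * (κ / (κ + D)) := by
  have hK : 0 ≤ K := hκ.trans hκK
  rw [div_mul_eq_mul_div, mul_div_assoc]
  exact mul_le_mul_of_nonneg_left (div_le_div_of_nonneg_left hκ (by positivity) (by linarith))
    (by positivity)

/-- A test function at the scale `b ~ 1 / κ` gives decay at most like `κ ^ (d / 4)`. -/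
theorem exists_scale_bound {d κ K : ℝ} (hd : 0 ≤ d) (hκ : 0 < κ) (hκK : κ ≤ K) {N : ℕ}
    (hN : 1 ≤ N) :
    ∃ b : ℕ, N ≤ b ∧
      (4 * Real.pi * (N * (1 + K) + K)) ^ (-(d / 4)) / (1 + d / 2) * κ ^ (d / 4)
        ≤ (4 * Real.pi * b) ^ (-(d / 4)) * (κ / (κ + d / (2 * b))) := by
  have hpi := Real.pi_pos
  have hN' : (1 : ℝ) ≤ N := by exact_mod_cast hN
  have hK : 0 < K := hκ.trans_le hκK
  -- This choice gives N(1+K) ≤ bκ ≤ N(1+K) + K. With κ ≤ K the lower bound yields b ≥ N, and it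
  -- yields bκ ≥ 1, so that d/(2b) ≤ κ d/2; the upper bound controls b^(-d/4).
  let b : ℕ := ⌈N * (1 + K) / κ⌉₊
  have hb1 : N * (1 + K) / κ ≤ b := Nat.le_ceil _
  have hb2 : (b : ℝ) < N * (1 + K) / κ + 1 := Nat.ceil_lt_add_one (by positivity)
  rw [div_le_iff₀ hκ] at hb1
  have hbκ : b * κ ≤ N * (1 + K) + K := by
    have := mul_lt_mul_of_pos_right hb2 hκ
    rw [add_mul, div_mul_cancel₀ _ hκ.ne'] at this
    linarith
  have hNb : (N : ℝ) ≤ b := by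
    by_contra! h
    nlinarith [mul_le_mul_of_nonneg_right h.le hκ.le, mul_le_mul_of_nonneg_left hκK (show (0:ℝ) ≤ N by linarith)]
  have hb0 : (0 : ℝ) < b := by linarith
  refine ⟨b, by exact_mod_cast hNb, ?_⟩
  set Q := N * (1 + K) + K with hQ
  have hQ0 : 0 < Q := by positivity
  have h1 : 1 / (1 + d / 2) ≤ κ / (κ + d / (2 * b)) := by
    rw [div_le_div_iff₀ (by positivity) (by positivity)]
    have : d / (2 * b) ≤ κ * (d / 2) := by
      rw [div_le_iff₀ (by positivity)]
      have : 1 ≤ b * κ := by nlinarith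
      nlinarith [mul_le_mul_of_nonneg_left this hd]
    linarith
  have h2 : (4 * Real.pi * Q) ^ (-(d / 4)) * κ ^ (d / 4) ≤ (4 * Real.pi * b) ^ (-(d / 4)) := by
    calc _ = (4 * Real.pi * (Q / κ)) ^ (-(d / 4)) := by
          rw [← mul_div_assoc, Real.div_rpow (by positivity) hκ.le, Real.rpow_neg hκ.le,
            div_inv_eq_mul]
      _ ≤ _ := by
          refine Real.rpow_le_rpow_of_nonpos (by positivity) ?_ (by linarith)
          have : (b : ℝ) ≤ Q / κ := (le_div_iff₀ hκ).2 hbκ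
          gcongr
  calc _ = (4 * Real.pi * Q) ^ (-(d / 4)) * κ ^ (d / 4) * (1 / (1 + d / 2)) := by ring
    _ ≤ _ := mul_le_mul h2 h1 (by positivity) (by positivity)

end Subdiffusion

end

theorem theorem4p1 (d : ℕ) (hd : 1 ≤ d) (k : ℝ → ℝ) (hk : Subdiffusion.IsPC k)
    (u₀ : EuclideanSpace ℝ (Fin d) → ℂ)
    (hu₁ : MeasureTheory.MemLp u₀ 1 MeasureTheory.volume)
    (hu₂ : MeasureTheory.MemLp u₀ 2 MeasureTheory.volume)
    (hu₀ : Subdiffusion.fourier u₀ 0 ≠ 0) :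
    ∃ c : ℝ, 0 < c ∧ ∀ᵐ t : ℝ ∂MeasureTheory.volume, 1 ≤ t →
      MeasureTheory.MemLp (Subdiffusion.solution k u₀ t) 2 MeasureTheory.volume ∧
      c * k t ^ min (1 : ℝ) ((d : ℝ) / 4) ≤
        (MeasureTheory.eLpNorm (Subdiffusion.solution k u₀ t) 2 MeasureTheory.volume).toReal := by
  have hk' := hk.isDecreasingKernel
  have hv := MeasureTheory.memLp_one_iff_integrable.1 hu₁
  rw [Subdiffusion.fourier_zero] at hu₀
  have hU : 0 < ‖∫ y, u₀ y‖ / 2 := half_pos (norm_pos_iff.2 hu₀)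
  have hd0 : (0 : ℝ) < d := by exact_mod_cast hd
  have hpi := Real.pi_pos
  obtain ⟨N, hN, hbound⟩ := Subdiffusion.ae_le_eLpNorm_solution hd hk' hv hu₂ hu₀
  have hN0 : (0 : ℝ) < N := by exact_mod_cast hN
  have hK : 0 ≤ k 1 := hk'.nonneg 1 one_pos
  have hkK : ∀ t, 1 ≤ t → k t ≤ k 1 := fun t ht =>
    hk'.antitone (Set.mem_Ioi.2 one_pos) (Set.mem_Ioi.2 (one_pos.trans_le ht)) ht
  -- For d ≥ 4 the fixed scale N suffices; for d ≤ 4 the scale is of order 1/k(t). In both cases k 1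
  -- bounds k(t) on t ≥ 1.
  rcases le_total (1 : ℝ) ((d : ℝ) / 4) with h4 | h4
  · refine ⟨‖∫ y, u₀ y‖ / 2 * (4 * Real.pi * N) ^ (-((d : ℝ) / 4)) / (k 1 + d / (2 * N)),
      by positivity, ?_⟩
    filter_upwards [hbound] with t hb ht
    have ht0 : 0 < t := one_pos.trans_le ht
    refine ⟨Subdiffusion.memLp_solution hk' hu₂ ht0.le, ?_⟩
    rw [min_eq_left h4, Real.rpow_one]
    exact (Subdiffusion.fixed_scale_bound (hk'.nonneg t ht0) (hkK t ht) hU (by positivity)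
      (by positivity)).trans (hb ht0 N le_rfl)
  · refine ⟨‖∫ y, u₀ y‖ / 2 * ((4 * Real.pi * (N * (1 + k 1) + k 1)) ^ (-((d : ℝ) / 4))
      / (1 + d / 2)), by positivity, ?_⟩
    filter_upwards [hbound] with t hb ht
    have ht0 : 0 < t := one_pos.trans_le ht
    refine ⟨Subdiffusion.memLp_solution hk' hu₂ ht0.le, ?_⟩
    rw [min_eq_right h4]
    -- If k t = 0 there is no scale 1/k(t), but the bound is trivial because the exponent d/4 is
    -- positive.
    rcases (hk'.nonneg t ht0).eq_or_lt with h0 | h0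
    · rw [← h0, Real.zero_rpow (by positivity), mul_zero]
      exact ENNReal.toReal_nonneg
    · obtain ⟨b, hNb, hle⟩ := Subdiffusion.exists_scale_bound hd0.le h0 (hkK t ht) hN
      refine le_trans ?_ (hb ht0 b hNb)
      have := mul_le_mul_of_nonneg_left hle hU.le
      rwa [← mul_assoc, ← mul_assoc] at this
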